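/- **Definitions (algebras).** All rings are commutative with $1$. An *$\ell$-algebra* is an $\mathbb R$-algebra $A$ with a lattice order such that $a\le b$ implies $a+c\le b+c$, $0\le a,b$ implies $0\le ab$, and $0\le a$, $0\le\lambda\in\mathbb R$ imply $0\le\lambda a$. It is *bounded* if for every $a\in A$ there is $n\in\mathbb N$ with $a\le n\cdot 1$, and *archimedean* if $n a\le b$ for all $n\in\mathbb N$ implies $a\le 0$. Write $\lambda$ for $\lambda\cdot 1\in A$, $a^+=a\vee 0$, $|a|=a\vee(-a)$, and $\|a\|=\inf\{\lambda\in\mathbb R: |a|\le\lambda\}$; $A$ is *uniformly complete* if it is complete for $\|\cdot\|$. A *modal operator* on a bounded archimedean $\ell$-algebra $A$ is a map $\Box:A\to A$ such that, for all $a,b\in A$ and $\lambda\in\mathbb R$, - $\Box(a\wedge b)=\Box a\wedge\Box b$, - $\Box\lambda=\lambda+(1-\lambda)\Box 0$, - $\Box(a^+)=(\Box a)^+$, - $\Box(a+\lambda)=\Box a+\Box\lambda-\Box 0$, - $\Box(\lambda a)=(\Box\lambda)(\Box a)$ if $\lambda\ge 0$. Let $\mathbf{mba\ell}$ be the category of pairs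 $(A,\Box)$ of this kind, with the unital $\ell$-algebra homomorphisms (unital $\mathbb R$-algebra and lattice homomorphisms) preserving $\Box$, and let $\mathbf{muba\ell}$ be its full subcategory of uniformly complete objects. **Definitions (frames).** For a relation $R$ on $X$ put $R[x]=\{y: xRy\}$ and $R^{-1}[U]=\{x: xRy\text{ for some }y\in U\}$. A relation $R$ on a compact Hausdorff space $X$ is *continuous* if $R[x]$ is closed for each $x\in X$, $R^{-1}[F]$ is closed for each closed $F$, and $R^{-1}[U]$ is open for each open $U$. Let $\mathsf{KHK}$ be the category of pairs $(X,R)$ of a compact Hausdorff space and a continuous relation on it, with morphisms $(X,R)\to(Y,S)$ the continuous maps $f$ such that $f(R[x])=S[f(x)]$ for all $x\in X$. **Definitions (functors).** For $(X,R)\in\mathsf{KHK}$ let $(X,R)^*=(C(X),\Box_R)$, where $C(X)$ is the algebra of continuous real-valued functions on $X$ and $(\Box_Rf)(x)=\inf f(R[x])$ if $R[x]\neq\varnothing$, $(\Box_Rf)(x)=1$ otherwise; for a morphism $\varphi$ let $\varphi^*(f)=f\circ\varphi$. For $(A,\Box)\in\mathbf{mba\ell}$ let $(A,\Box)_*=(Y_A,R_\Box)$,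 where $Y_A$ is the set of maximal $\ell$-ideals of $A$ (an ideal $I$ is an $\ell$-ideal if $|a|\le|b|$ and $b\in I$ imply $a\in I$; maximal means maximal among the proper $\ell$-ideals), the closed sets of $Y_A$ are the sets $\{M\in Y_A: I\subseteq M\}$ with $I$ an $\ell$-ideal, and $x R_\Box y$ iff $\Box a\in x$ for every $a\in y$ with $a\ge 0$; for a morphism $\alpha$ let $\alpha_*(M)=\alpha^{-1}(M)$. **Theorem.** The assignments $(-)^*:\mathsf{KHK}\to\mathbf{mba\ell}$ and $(-)_*:\mathbf{mba\ell}\to\mathsf{KHK}$ are well-defined contravariant functors, and they form a dual adjunction, that is, $(-)_*:\mathbf{mba\ell}\to\mathsf{KHK}^{\mathrm{op}}$ is left adjoint to $(-)^*:\mathsf{KHK}^{\mathrm{op}}\to\mathbf{mba\ell}$. Its unit and counit are given by the maps $\zeta_A:A\to C(Y_A)$, where $\zeta_A(a)(M)$ is the unique real number $\lambda$ with $a+M=\lambda+M$, and $\varepsilon_X:X\to Y_{C(X)}$, $\varepsilon_X(x)=\{f\in C(X): f(x)=0\}$. Moreover: 1. The values of $(-)^*$ lie in $\mathbf{muba\ell}$,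 and $\mathbf{muba\ell}$ is a reflective subcategory of $\mathbf{mba\ell}$, with reflector $(A,\Box)\mapsto(C(Y_A),\Box_{R_\Box})$ and unit $\zeta$. 2. The dual adjunction restricts to a dual equivalence between $\mathbf{muba\ell}$ and $\mathsf{KHK}$: $\zeta_A$ is an isomorphism for every $A\in\mathbf{muba\ell}$, $\varepsilon_X$ is an isomorphism for every $X\in\mathsf{KHK}$, and the restricted functors form an equivalence $\mathbf{muba\ell}\simeq\mathsf{KHK}^{\mathrm{op}}$. -/

import Mathlib

open CategoryTheory Opposite

universe u

/-! ### Bounded archimedean lattice-ordered algebras -/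

/-- A commutative unital `ℝ`-algebra with a lattice order is a bounded archimedean `ℓ`-algebra. -/
structure IsBAL (A : Type u) [CommRing A] [Lattice A] [Algebra ℝ A] : Prop where
  add_le_add : ∀ a b c : A, a ≤ b → a + c ≤ b + c
  mul_nonneg : ∀ a b : A, 0 ≤ a → 0 ≤ b → 0 ≤ a * b
  smul_nonneg : ∀ (r : ℝ) (a : A), 0 ≤ r → 0 ≤ a → 0 ≤ r • a
  bounded : ∀ a : A, ∃ n : ℕ, a ≤ n • (1 : A)
  archimedean : ∀ a b : A, (∀ n : ℕ, n • a ≤ b) → a ≤ 0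

/-- The norm `‖a‖ = inf {r | |a| ≤ r}`. The set is nonempty by boundedness, and bounded below
unless `A` is the zero ring, where the value is `0`. -/
noncomputable def balNorm {A : Type u} [CommRing A] [Lattice A] [Algebra ℝ A] (a : A) : ℝ :=
  sInf {r : ℝ | |a| ≤ algebraMap ℝ A r}

/-- Uniform completeness: every sequence that is Cauchy for the norm converges in the norm. -/
def IsUniformlyComplete (A : Type u) [CommRing A] [Lattice A] [Algebra ℝ A] : Prop :=
  ∀ s : ℕ → A,
    (∀ ε : ℝ, 0 < ε → ∃ N : ℕ, ∀ m ≥ N, ∀ n ≥ N, balNorm (s m - s n) < ε) →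
    ∃ a : A, ∀ ε : ℝ, 0 < ε → ∃ N : ℕ, ∀ n ≥ N, balNorm (s n - a) < ε

/-- Modal operators. The positive part of `a` is `a ⊔ 0`, and reals are viewed in `A` through
`algebraMap ℝ A`. -/
structure IsModalOperator {A : Type u} [CommRing A] [Lattice A] [Algebra ℝ A]
    (box : A → A) : Prop where
  box_inf : ∀ a b : A, box (a ⊓ b) = box a ⊓ box b
  box_const : ∀ r : ℝ,
    box (algebraMap ℝ A r) = algebraMap ℝ A r + (1 - algebraMap ℝ A r) * box 0
  box_pos : ∀ a : A, box (a ⊔ 0) = box a ⊔ 0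
  box_add_const : ∀ (a : A) (r : ℝ),
    box (a + algebraMap ℝ A r) = box a + box (algebraMap ℝ A r) - box 0
  box_smul : ∀ (a : A) (r : ℝ), 0 ≤ r → box (r • a) = box (algebraMap ℝ A r) * box a

/-! ### The category of modal bounded archimedean `ℓ`-algebras -/

/-- Modal bounded archimedean `ℓ`-algebras. -/
structure MBAL : Type (u + 1) where
  carrier : Type u
  [commRing : CommRing carrier]
  [lattice : Lattice carrier]
  [algebra : Algebra ℝ carrier]
  isBAL : IsBAL carrier
  box : carrier → carrier
  isModal : IsModalOperator box

namespace MBAL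

instance : CoeSort MBAL.{u} (Type u) := ⟨MBAL.carrier⟩

attribute [instance] MBAL.commRing MBAL.lattice MBAL.algebra

/-- Unital `ℓ`-algebra homomorphisms preserving the modal operator. -/
@[ext]
structure Hom (A B : MBAL.{u}) : Type u where
  toAlgHom : A →ₐ[ℝ] B
  map_sup : ∀ a b : A, toAlgHom (a ⊔ b) = toAlgHom a ⊔ toAlgHom b
  map_inf : ∀ a b : A, toAlgHom (a ⊓ b) = toAlgHom a ⊓ toAlgHom b
  map_box : ∀ a : A, toAlgHom (A.box a) = B.box (toAlgHom a)

instance : Category MBAL.{u} where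
  Hom A B := Hom A B
  id A :=
    { toAlgHom := AlgHom.id ℝ A
      map_sup := fun _ _ => rfl
      map_inf := fun _ _ => rfl
      map_box := fun _ => rfl }
  comp {A B C} f g :=
    { toAlgHom := g.toAlgHom.comp f.toAlgHom
      map_sup := fun a b => by simp [f.map_sup, g.map_sup]
      map_inf := fun a b => by simp [f.map_inf, g.map_inf]
      map_box := fun a => by simp [f.map_box, g.map_box] }

/-- The objects of `MBAL` that are uniformly complete. -/
def uniformlyComplete : ObjectProperty MBAL.{u} :=
  fun A => IsUniformlyComplete A

end MBAL

/-- The full subcategory of uniformly complete modal bounded archimedean `ℓ`-algebras. -/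
abbrev MUBAL : Type (u + 1) := MBAL.uniformlyComplete.{u}.FullSubcategory

/-! ### The category of compact Hausdorff frames -/

/-- The image `R[x]` of a point under a relation. -/
def relImage {X : Type u} (R : X → X → Prop) (x : X) : Set X := {y | R x y}

/-- The preimage `R⁻¹[U]` of a set under a relation. -/
def relPreimage {X : Type u} (R : X → X → Prop) (U : Set X) : Set X := {x | ∃ y ∈ U, R x y}

/-- Continuous relations on a topological space. -/
structure IsContinuousRel {X : Type u} [TopologicalSpace X] (R : X → X → Prop) : Prop where
  isClosed_image : ∀ x : X, IsClosed (relImage R x)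
  isClosed_preimage : ∀ F : Set X, IsClosed F → IsClosed (relPreimage R F)
  isOpen_preimage : ∀ U : Set X, IsOpen U → IsOpen (relPreimage R U)

/-- Bounded morphisms (p-morphisms) of Kripke frames: `f(R[x]) = S[f(x)]`. -/
def IsBoundedMorphism {X Y : Type u} (R : X → X → Prop) (S : Y → Y → Prop) (f : X → Y) : Prop :=
  ∀ x : X, f '' relImage R x = relImage S (f x)

/-- Compact Hausdorff frames. -/
structure KHK : Type (u + 1) where
  carrier : Type u
  [topologicalSpace : TopologicalSpace carrier]
  [compactSpace : CompactSpace carrier]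
  [t2Space : T2Space carrier]
  rel : carrier → carrier → Prop
  isContinuousRel : IsContinuousRel rel

namespace KHK

instance : CoeSort KHK.{u} (Type u) := ⟨KHK.carrier⟩

attribute [instance] KHK.topologicalSpace KHK.compactSpace KHK.t2Space

/-- Continuous bounded morphisms. -/
@[ext]
structure Hom (X Y : KHK.{u}) : Type u where
  toContinuousMap : C(X, Y)
  isBounded : IsBoundedMorphism X.rel Y.rel toContinuousMap

instance : Category KHK.{u} where
  Hom X Y := Hom X Y
  id X :=
    { toContinuousMap := ContinuousMap.id X
      isBounded := fun x => by simp }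
  comp {X Y Z} f g :=
    { toContinuousMap := g.toContinuousMap.comp f.toContinuousMap
      isBounded := fun x => by
        rw [ContinuousMap.coe_comp, Set.image_comp, f.isBounded x, g.isBounded]
        rfl }

end KHK

/-! ### From compact Hausdorff frames to algebras -/

/-- The ring of continuous real-valued functions on a compact space, with pointwise operations
and order, is a bounded archimedean `ℓ`-algebra. -/
theorem isBAL_continuousMap (X : Type u) [TopologicalSpace X] [CompactSpace X] :
    IsBAL C(X, ℝ) where
  add_le_add a b c h := fun x => by
    have := h x
    simpa using this
  mul_nonneg a b ha hb := fun x => _root_.mul_nonneg (ha x) (hb x)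
  smul_nonneg r a hr ha := fun x => _root_.mul_nonneg hr (ha x)
  bounded a := by
    obtain ⟨n, hn⟩ := exists_nat_ge ‖a‖
    refine ⟨n, fun x => ?_⟩
    have h1 : a x ≤ ‖a‖ := (le_abs_self _).trans (a.norm_coe_le_norm x)
    simpa using h1.trans hn
  archimedean a b h := fun x => by
    by_contra hx
    have hx' : 0 < a x := not_le.mp hx
    obtain ⟨n, hn⟩ := Archimedean.arch (b x + 1) hx'
    have h1 : n • a x ≤ b x := h n x
    linarith

open Classical in
/-- The function `□_R f`: the infimum of `f` over `R[x]` if `R[x]` is nonempty, and `1` otherwise. -/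
noncomputable def boxFun (X : KHK.{u}) (f : C(X, ℝ)) : X → ℝ := fun x =>
  if (relImage X.rel x).Nonempty then sInf (f '' relImage X.rel x) else 1

/-- The assignments `(X, R) ↦ (C(X), □_R)` and `φ ↦ (f ↦ f ∘ φ)` land in `MBAL`. -/
structure StarWellDefined : Prop where
  continuous_box : ∀ (X : KHK.{u}) (f : C(X, ℝ)), Continuous (boxFun X f)
  isModal : ∀ X : KHK.{u},
    IsModalOperator (fun f : C(X, ℝ) => (⟨boxFun X f, continuous_box X f⟩ : C(X, ℝ)))
  map_box : ∀ (X Y : KHK.{u}) (φ : X ⟶ Y) (f : C(Y, ℝ)) (x : X),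
    boxFun Y f (φ.toContinuousMap x) = boxFun X (f.comp φ.toContinuousMap) x

/-- The algebra `(C(X), □_R)`. -/
noncomputable def starObj (h : StarWellDefined.{u}) (X : KHK.{u}) : MBAL.{u} where
  carrier := C(X, ℝ)
  isBAL := isBAL_continuousMap X
  box := fun f => ⟨boxFun X f, h.continuous_box X f⟩
  isModal := h.isModal X

/-- The homomorphism `f ↦ f ∘ φ`. -/
noncomputable def starMap (h : StarWellDefined.{u}) {X Y : KHK.{u}} (φ : X ⟶ Y) :
    starObj h Y ⟶ starObj h X where
  toAlgHom := ContinuousMap.compRightAlgHom ℝ ℝ φ.toContinuousMap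
  map_sup _ _ := rfl
  map_inf _ _ := rfl
  map_box f := ContinuousMap.ext fun x => h.map_box X Y φ f x

/-- The contravariant functor `(X, R) ↦ (C(X), □_R)`. -/
noncomputable def starFunctor (h : StarWellDefined.{u}) : KHK.{u}ᵒᵖ ⥤ MBAL.{u} where
  obj X := starObj h X.unop
  map φ := starMap h φ.unop
  map_id _ := rfl
  map_comp _ _ := rfl

/-! ### From algebras to compact Hausdorff frames -/

section Yosida

variable {A : Type u} [CommRing A] [Lattice A] [Algebra ℝ A]

/-- `ℓ`-ideals. -/
def IsLIdeal (I : Ideal A) : Prop := ∀ a b : A, |a| ≤ |b| → b ∈ I → a ∈ I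

/-- Maximal `ℓ`-ideals: the maximal elements among the proper `ℓ`-ideals. -/
def IsMaximalLIdeal (M : Ideal A) : Prop := Maximal (fun I : Ideal A => IsLIdeal I ∧ I ≠ ⊤) M

theorem IsBAL.isOrderedAddMonoid (hA : IsBAL A) : IsOrderedAddMonoid A where
  add_le_add_left a b h c := hA.add_le_add a b c h

theorem IsBAL.mul_le_mul_right (hA : IsBAL A) {a b c : A} (h : a ≤ b) (hc : 0 ≤ c) :
    a * c ≤ b * c := by
  have hO := hA.isOrderedAddMonoid
  have := hA.mul_nonneg (b - a) c (sub_nonneg.mpr h) hc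
  rwa [sub_mul, sub_nonneg] at this

theorem IsBAL.mul_le_abs_mul_abs (hA : IsBAL A) (a b : A) : a * b ≤ |a| * |b| := by
  have hO := hA.isOrderedAddMonoid
  have h1 := hA.mul_nonneg (|a| - a) (|b| + b) (sub_nonneg.mpr (le_abs_self a))
    (by rw [← sub_neg_eq_add]; exact sub_nonneg.mpr (neg_le_abs b))
  have h2 := hA.mul_nonneg (|a| + a) (|b| - b)
    (by rw [← sub_neg_eq_add]; exact sub_nonneg.mpr (neg_le_abs a)) (sub_nonneg.mpr (le_abs_self b))
  have h3 := hA.smul_nonneg (1 / 2) _ (by norm_num) (add_nonneg h1 h2)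
  have h4 : (|a| - a) * (|b| + b) + (|a| + a) * (|b| - b) = (2 : ℝ) • (|a| * |b| - a * b) := by
    rw [two_smul]; ring
  rw [h4, smul_smul] at h3
  norm_num at h3
  exact h3

theorem IsBAL.abs_mul_le (hA : IsBAL A) (a b : A) : |a * b| ≤ |a| * |b| := by
  refine sup_le (hA.mul_le_abs_mul_abs a b) ?_
  have := hA.mul_le_abs_mul_abs (-a) b
  rwa [abs_neg, neg_mul] at this

theorem IsLIdeal.abs_mem (hA : IsBAL A) {I : Ideal A} (hI : IsLIdeal I) {a : A} (ha : a ∈ I) :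
    |a| ∈ I := by
  have hO := hA.isOrderedAddMonoid
  exact hI |a| a (by rw [abs_abs]) ha

/-- If `a` lies outside the maximal `ℓ`-ideal `M`, then `1 ≤ m + n |a|` for some `m ∈ M`. -/
theorem IsMaximalLIdeal.exists_one_le (hA : IsBAL A) {M : Ideal A} (hM : IsMaximalLIdeal M)
    {a : A} (ha : a ∉ M) : ∃ m ∈ M, ∃ n : ℕ, (1 : A) ≤ m + n • |a| := by
  have hO := hA.isOrderedAddMonoid
  let J : Ideal A :=
    { carrier := {c | ∃ m ∈ M, ∃ n : ℕ, |c| ≤ m + n • |a|}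
      zero_mem' := ⟨0, M.zero_mem, 0, by simp⟩
      add_mem' := by
        rintro c d ⟨m, hm, n, h⟩ ⟨m', hm', n', h'⟩
        refine ⟨m + m', M.add_mem hm hm', n + n', ?_⟩
        calc |c + d| ≤ |c| + |d| := abs_add_le c d
          _ ≤ (m + n • |a|) + (m' + n' • |a|) := add_le_add h h'
          _ = m + m' + (n + n') • |a| := by rw [add_smul]; abel
      smul_mem' := by
        rintro r c ⟨m, hm, n, h⟩
        obtain ⟨k, hk⟩ := hA.bounded |r|
        refine ⟨k • m, M.nsmul_mem hm k, k * n, ?_⟩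
        calc |r • c| ≤ |r| * |c| := hA.abs_mul_le r c
          _ ≤ (k • (1 : A)) * |c| := hA.mul_le_mul_right hk (abs_nonneg c)
          _ = k • |c| := by rw [smul_mul_assoc, one_mul]
          _ ≤ k • (m + n • |a|) := nsmul_le_nsmul_right h k
          _ = k • m + (k * n) • |a| := by rw [smul_add, mul_smul] }
  have hJ : IsLIdeal J := by
    rintro c d hcd ⟨m, hm, n, h⟩
    exact ⟨m, hm, n, hcd.trans h⟩
  have hMJ : M ≤ J := fun c hc => ⟨|c|, hM.prop.1.abs_mem hA hc, 0, by simp⟩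
  have haJ : a ∈ J := ⟨0, M.zero_mem, 1, by simp⟩
  have hJtop : J = ⊤ := by
    by_contra hne
    exact ha (hM.le_of_ge ⟨hJ, hne⟩ hMJ haJ)
  have h1 : (1 : A) ∈ J := by rw [hJtop]; trivial
  obtain ⟨m, hm, n, h⟩ := h1
  exact ⟨m, hm, n, (le_abs_self 1).trans h⟩

/-- A maximal `ℓ`-ideal that contains `|a| |b|` contains `a` or `b`. -/
theorem IsMaximalLIdeal.mem_or_mem (hA : IsBAL A) {M : Ideal A} (hM : IsMaximalLIdeal M)
    {a b : A} (hab : |a| * |b| ∈ M) : a ∈ M ∨ b ∈ M := by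
  have hO := hA.isOrderedAddMonoid
  by_contra hcon
  push Not at hcon
  obtain ⟨m, hm, n, h⟩ := hM.exists_one_le hA hcon.1
  obtain ⟨m', hm', n', h'⟩ := hM.exists_one_le hA hcon.2
  have h0 : (0 : A) ≤ 1 := by
    obtain ⟨k, hk⟩ := hA.bounded (-1)
    have h1 : (0 : A) ≤ ((k : ℝ) + 1) • (1 : A) := by
      rw [add_smul, one_smul, Nat.cast_smul_eq_nsmul]
      have := add_le_add_left hk 1
      simpa using this
    have h2 := hA.smul_nonneg ((k : ℝ) + 1)⁻¹ _ (by positivity) h1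
    rwa [smul_smul, inv_mul_cancel₀ (by positivity), one_smul] at h2
  have h2 : (1 : A) ≤ (m + n • |a|) * (m' + n' • |b|) := by
    calc (1 : A) ≤ m' + n' • |b| := h'
      _ = 1 * (m' + n' • |b|) := (one_mul _).symm
      _ ≤ _ := hA.mul_le_mul_right h (h0.trans h')
  have h3 : (m + n • |a|) * (m' + n' • |b|) ∈ M := by
    have : (m + n • |a|) * (m' + n' • |b|)
        = m * (m' + n' • |b|) + (n • |a|) * m' + (n * n') • (|a| * |b|) := by
      rw [add_mul, mul_add (n • |a|), smul_mul_smul_comm, add_assoc]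
    rw [this]
    exact M.add_mem (M.add_mem (M.mul_mem_right _ hm) (M.mul_mem_left _ hm'))
      (M.nsmul_mem hab _)
  refine hM.prop.2 ((Ideal.eq_top_iff_one M).mpr (hM.prop.1 1 _ ?_ h3))
  rw [abs_of_nonneg h0]
  exact h2.trans (le_abs_self _)

end Yosida

namespace MBAL

/-- The set of maximal `ℓ`-ideals of `A`. -/
structure Yosida (A : MBAL.{u}) : Type u where
  ideal : Ideal A
  isMaximal : IsMaximalLIdeal ideal

/-- The set `Z(I)` of maximal `ℓ`-ideals that contain `I`. -/
def zeroSet (A : MBAL.{u}) (I : Ideal A) : Set A.Yosida := {M | I ≤ M.ideal}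

/-- The topology of the Yosida space: the closed sets are exactly the sets `Z(I)` for `ℓ`-ideals
`I`. -/
instance (A : MBAL.{u}) : TopologicalSpace A.Yosida :=
  TopologicalSpace.ofClosed {F | ∃ I : Ideal A, IsLIdeal I ∧ F = A.zeroSet I}
    ⟨⊤, fun _ _ _ _ => trivial, by
      ext M
      simpa [zeroSet] using M.isMaximal.prop.2⟩
    (by
      intro T hT
      refine ⟨sInf {I | IsLIdeal I ∧ ∀ F ∈ T, ∀ J : Ideal A, IsLIdeal J → F = A.zeroSet J → J ≤ I},
        ?_, ?_⟩
      · intro a b hab hb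
        rw [Submodule.mem_sInf] at hb ⊢
        exact fun I hI => hI.1 a b hab (hb I hI)
      · ext M
        constructor
        · intro hM
          have hmem : M.ideal ∈ {I : Ideal A | IsLIdeal I ∧
              ∀ F ∈ T, ∀ J : Ideal A, IsLIdeal J → F = A.zeroSet J → J ≤ I} := by
            refine ⟨M.isMaximal.prop.1, fun F hF J hJ hFJ => ?_⟩
            have hMF : M ∈ F := hM F hF
            rwa [hFJ] at hMF
          exact sInf_le hmem
        · intro hM F hF
          obtain ⟨J, hJ, rfl⟩ := hT hF
          have hle : J ≤ sInf {I : Ideal A | IsLIdeal I ∧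
              ∀ F ∈ T, ∀ J : Ideal A, IsLIdeal J → F = A.zeroSet J → J ≤ I} :=
            le_sInf fun I hI => hI.2 _ hF J hJ rfl
          exact le_trans hle hM)
    (by
      rintro F ⟨I, hI, rfl⟩ G ⟨J, hJ, rfl⟩
      refine ⟨I ⊓ J, fun a b hab hb => ⟨hI a b hab hb.1, hJ a b hab hb.2⟩, ?_⟩
      ext M
      constructor
      · rintro (h | h)
        · exact le_trans inf_le_left (show I ≤ M.ideal from h)
        · exact le_trans inf_le_right (show J ≤ M.ideal from h)
      · intro h
        by_contra hcon
        have hcon' : ¬ (I ≤ M.ideal) ∧ ¬ (J ≤ M.ideal) := not_or.mp hcon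
        obtain ⟨a, haI, ha⟩ := SetLike.not_le_iff_exists.mp hcon'.1
        obtain ⟨b, hbJ, hb⟩ := SetLike.not_le_iff_exists.mp hcon'.2
        have hab : |a| * |b| ∈ M.ideal :=
          h ⟨I.mul_mem_right _ (hI.abs_mem A.isBAL haI), J.mul_mem_left _ (hJ.abs_mem A.isBAL hbJ)⟩
        exact (M.isMaximal.mem_or_mem A.isBAL hab).elim ha hb)

/-- The relation `R_□` on the Yosida space: `x R_□ y` iff `□ a ∈ x` for every `0 ≤ a ∈ y`. -/
def yosidaRel (A : MBAL.{u}) (x y : A.Yosida) : Prop :=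
  ∀ a ∈ y.ideal, 0 ≤ a → A.box a ∈ x.ideal

end MBAL

/-- The assignments `(A, □) ↦ (Y_A, R_□)` and `α ↦ α⁻¹` land in `KHK`. -/
structure YosidaWellDefined : Prop where
  compactSpace : ∀ A : MBAL.{u}, CompactSpace A.Yosida
  t2Space : ∀ A : MBAL.{u}, T2Space A.Yosida
  isContinuousRel : ∀ A : MBAL.{u}, IsContinuousRel A.yosidaRel
  isMaximal_comap : ∀ (A B : MBAL.{u}) (α : A ⟶ B) (M : B.Yosida),
    IsMaximalLIdeal (M.ideal.comap α.toAlgHom)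
  continuous_comap : ∀ (A B : MBAL.{u}) (α : A ⟶ B),
    Continuous (fun M : B.Yosida =>
      (⟨M.ideal.comap α.toAlgHom, isMaximal_comap A B α M⟩ : A.Yosida))
  isBounded_comap : ∀ (A B : MBAL.{u}) (α : A ⟶ B),
    IsBoundedMorphism B.yosidaRel A.yosidaRel (fun M : B.Yosida =>
      (⟨M.ideal.comap α.toAlgHom, isMaximal_comap A B α M⟩ : A.Yosida))

/-- The compact Hausdorff frame `(Y_A, R_□)`. -/
def yosidaObj (h : YosidaWellDefined.{u}) (A : MBAL.{u}) : KHK.{u} where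
  carrier := A.Yosida
  compactSpace := h.compactSpace A
  t2Space := h.t2Space A
  rel := A.yosidaRel
  isContinuousRel := h.isContinuousRel A

/-- The continuous bounded morphism `M ↦ α⁻¹(M)`. -/
def yosidaMap (h : YosidaWellDefined.{u}) {A B : MBAL.{u}} (α : A ⟶ B) :
    yosidaObj h B ⟶ yosidaObj h A where
  toContinuousMap := ⟨_, h.continuous_comap A B α⟩
  isBounded := h.isBounded_comap A B α

/-- The contravariant functor `(A, □) ↦ (Y_A, R_□)`. -/
def yosidaFunctor (h : YosidaWellDefined.{u}) : MBAL.{u}ᵒᵖ ⥤ KHK.{u} where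
  obj A := yosidaObj h A.unop
  map α := yosidaMap h α.unop
  map_id _ := rfl
  map_comp _ _ := rfl

/-- The element `f` of the algebra `C(X)`, as a continuous function. -/
def starObj.toFun (h : StarWellDefined.{u}) (X : KHK.{u}) (f : starObj h X) : C(X, ℝ) := f

/-- A point of the frame `Y_A`, as an ideal of `A`. -/
def yosidaObj.toIdeal (h : YosidaWellDefined.{u}) (A : MBAL.{u}) (M : yosidaObj h A) : Ideal A :=
  MBAL.Yosida.ideal M

/-- A morphism `z : A ⟶ C(Y_A)` is the canonical map `ζ_A` if `z(a)(M)` is, for all `a` and `M`,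
the unique real number `r` with `a + M = r + M`. -/
def IsZeta (hS : StarWellDefined.{u}) (hY : YosidaWellDefined.{u}) (A : MBAL.{u})
    (z : A ⟶ starObj hS (yosidaObj hY A)) : Prop :=
  ∀ (a : A) (M : yosidaObj hY A) (r : ℝ),
    starObj.toFun hS _ (z.toAlgHom a) M = r ↔ a - algebraMap ℝ A r ∈ yosidaObj.toIdeal hY A M

/-- A morphism `e : X ⟶ Y_{C(X)}` is the canonical map `ε_X` if `e(x)` is, for all `x`,
the ideal of the functions vanishing at `x`. -/
def IsEpsilon (hS : StarWellDefined.{u}) (hY : YosidaWellDefined.{u}) (X : KHK.{u})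
    (e : X ⟶ yosidaObj hY (starObj hS X)) : Prop :=
  ∀ (x : X) (f : starObj hS X),
    f ∈ yosidaObj.toIdeal hY _ (e.toContinuousMap x) ↔ starObj.toFun hS X f x = 0

/-! ### Arithmetic in bounded archimedean `ℓ`-algebras -/

namespace MBAL

variable {A : MBAL.{u}}

/-! Gelfand duality with an operator. A Dedekind cut identifies the quotient of `A` by a maximal
`ℓ`-ideal `M` with `ℝ` (`exists_sub_mem`), so points of `Y_A` are evaluations `M.val`, and `Y_A`
carries the weak topology of these. The archimedean axiom makes the order pointwise
(`nonneg_of_val_nonneg`). Hence `ζ` is an isometric embedding, with dense image by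
Stone–Weierstrass, and onto when `A` is uniformly complete.

For the operator, fix a point `x`. If `□0` is nonzero at `x`, then every `□a` is `1` there and `x`
has no successor. Otherwise `a ↦ (□a)(x)` is monotone, preserves meets, commutes with adding
constants and is positively homogeneous. The successors of `x` are the `y` with `(□a)(x) ≤ a(y)` for
all `a`, and `(□a)(x)` is the minimum of `a` over them. The key is `exists_rel_of_box_mem`, which
produces a successor containing a given `ℓ`-ideal. It yields the continuity of `R_□`, the
compatibility of `ζ` with `□`, and the back condition for `α⁻¹`.

For a frame `X`, Urysohn functions and compactness make `ε` a bijection that preserves and reflects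
the relation, hence an isomorphism. The triangle identities are checked by evaluation at points;
equivalence and reflection then follow formally from the invertibility of `ζ` on complete algebras
and of `ε`. -/

instance : IsOrderedAddMonoid A := A.isBAL.isOrderedAddMonoid

instance : PosSMulMono ℝ A where
  smul_le_smul_of_nonneg_left r hr a b hab := by
    have := A.isBAL.smul_nonneg r (b - a) hr (sub_nonneg.mpr hab)
    rwa [smul_sub, sub_nonneg] at this

/-- A bound for `-1` gives `0 ≤ (k + 1) • 1`, and the positive scalar can be divided out. -/
instance : ZeroLEOneClass A where
  zero_le_one := by
    obtain ⟨k, hk⟩ := A.isBAL.bounded (-1)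
    have h1 : (0 : A) ≤ ((k : ℝ) + 1) • (1 : A) := by
      rw [add_smul, one_smul, Nat.cast_smul_eq_nsmul]
      have := add_le_add_left hk 1
      simpa using this
    have h2 := A.isBAL.smul_nonneg ((k : ℝ) + 1)⁻¹ _ (by positivity) h1
    rwa [smul_smul, inv_mul_cancel₀ (by positivity), one_smul] at h2

instance : IsOrderedRing A :=
  IsOrderedRing.of_mul_nonneg A.isBAL.mul_nonneg

instance : IsOrderedModule ℝ A where
  smul_le_smul_of_nonneg_right a ha r s hrs := by
    have := A.isBAL.smul_nonneg (s - r) a (sub_nonneg.mpr hrs) ha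
    rwa [sub_smul, sub_nonneg] at this

theorem exists_le_algebraMap (a : A) : ∃ r : ℝ, a ≤ algebraMap ℝ A r := by
  obtain ⟨n, hn⟩ := A.isBAL.bounded a
  exact ⟨n, by simpa using hn⟩

/-- Boundedness puts `a * b` below a common multiple `k` of both factors, and scaling by a positive
real commutes with meets, so `a * b ≤ k • (a ⊓ b) = 0`. -/
theorem mul_eq_zero_of_inf_eq_zero {a b : A} (h : a ⊓ b = 0) : a * b = 0 := by
  have ha : 0 ≤ a := h ▸ inf_le_left
  have hb : 0 ≤ b := h ▸ inf_le_right
  obtain ⟨m, hm⟩ := A.isBAL.bounded a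
  obtain ⟨n, hn⟩ := A.isBAL.bounded b
  have h1 : a * b ≤ (m + n) • b := by
    calc a * b ≤ (m • (1 : A)) * b := mul_le_mul_of_nonneg_right hm hb
      _ = m • b := by simp
      _ ≤ (m + n) • b := nsmul_le_nsmul_left hb (by omega)
  have h2 : a * b ≤ (m + n) • a := by
    calc a * b ≤ a * (n • (1 : A)) := mul_le_mul_of_nonneg_left hn ha
      _ = n • a := by rw [mul_smul_comm, mul_one]
      _ ≤ (m + n) • a := nsmul_le_nsmul_left ha (by omega)
  have h3 : ∀ k : ℕ, (k • a) ⊓ (k • b) = 0 := by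
    intro k
    have key : ∀ (r : ℝ), 0 < r → (r • a) ⊓ (r • b) ≤ 0 := by
      intro r hr
      have h4 : r⁻¹ • ((r • a) ⊓ (r • b)) ≤ a ⊓ b := by
        refine le_inf ?_ ?_
        · calc r⁻¹ • ((r • a) ⊓ (r • b)) ≤ r⁻¹ • (r • a) :=
                smul_le_smul_of_nonneg_left inf_le_left (by positivity)
            _ = a := inv_smul_smul₀ hr.ne' a
        · calc r⁻¹ • ((r • a) ⊓ (r • b)) ≤ r⁻¹ • (r • b) :=
                smul_le_smul_of_nonneg_left inf_le_right (by positivity)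
            _ = b := inv_smul_smul₀ hr.ne' b
      have h5 := smul_le_smul_of_nonneg_left (h4.trans_eq h) hr.le
      rwa [smul_inv_smul₀ hr.ne', smul_zero] at h5
    rcases Nat.eq_zero_or_pos k with rfl | hk
    · simp
    · refine le_antisymm ?_ (le_inf (nsmul_nonneg ha k) (nsmul_nonneg hb k))
      have := key k (by exact_mod_cast hk)
      simpa [Nat.cast_smul_eq_nsmul] using this
  exact le_antisymm ((le_inf h2 h1).trans_eq (h3 _)) (mul_nonneg ha hb)

theorem posPart_mul_negPart (a : A) : a⁺ * a⁻ = 0 :=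
  mul_eq_zero_of_inf_eq_zero (posPart_inf_negPart_eq_zero a)

/-! ### Existence of maximal `ℓ`-ideals -/

theorem _root_.IsLIdeal.mem_of_le {I : Ideal A} (hI : IsLIdeal I) {a b : A} (ha : 0 ≤ a)
    (hab : a ≤ b) (hb : b ∈ I) : a ∈ I :=
  hI a b (by rwa [abs_of_nonneg ha, abs_of_nonneg (ha.trans hab)]) hb

theorem _root_.IsLIdeal.ne_top_iff {I : Ideal A} (hI : IsLIdeal I) :
    I ≠ ⊤ ↔ ∀ a ∈ I, ¬ (1 : A) ≤ a := by
  rw [Ne, Ideal.eq_top_iff_one]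
  exact ⟨fun h a ha h1 => h (hI.mem_of_le zero_le_one h1 ha), fun h h1 => h 1 h1 le_rfl⟩

theorem nonneg_of_mem_closure_abs {S : Set A} {d : A}
    (hd : d ∈ AddSubmonoid.closure (abs '' S)) : 0 ≤ d := by
  induction hd using AddSubmonoid.closure_induction with
  | mem x hx => obtain ⟨y, -, rfl⟩ := hx; exact abs_nonneg y
  | zero => exact le_rfl
  | add x y _ _ hx hy => exact add_nonneg hx hy

/-- The `ℓ`-ideal generated by a set. -/
def lSpan (S : Set A) : Ideal A where
  carrier := {c | ∃ d ∈ AddSubmonoid.closure (abs '' S), |c| ≤ d}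
  zero_mem' := ⟨0, zero_mem _, by simp⟩
  add_mem' := by
    rintro a b ⟨d, hd, had⟩ ⟨e, he, hbe⟩
    exact ⟨d + e, add_mem hd he, (abs_add_le a b).trans (add_le_add had hbe)⟩
  smul_mem' := by
    rintro r c ⟨d, hd, hcd⟩
    -- Boundedness absorbs the multiplier into an integer, so sums of absolute values suffice,
    -- without ring coefficients.
    obtain ⟨k, hk⟩ := A.isBAL.bounded |r|
    refine ⟨k • d, nsmul_mem hd k, ?_⟩
    calc |r • c| ≤ |r| * |c| := A.isBAL.abs_mul_le r c
      _ ≤ (k • (1 : A)) * |c| := mul_le_mul_of_nonneg_right hk (abs_nonneg c)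
      _ = k • |c| := by simp
      _ ≤ k • d := nsmul_le_nsmul_right hcd k

theorem isLIdeal_lSpan (S : Set A) : IsLIdeal (lSpan S) := by
  rintro a b hab ⟨d, hd, hbd⟩
  exact ⟨d, hd, hab.trans hbd⟩

theorem subset_lSpan (S : Set A) : S ⊆ lSpan S := fun a ha =>
  ⟨|a|, AddSubmonoid.subset_closure ⟨a, ha, rfl⟩, le_rfl⟩

theorem lSpan_le {S : Set A} {I : Ideal A} (hI : IsLIdeal I) : lSpan S ≤ I ↔ S ⊆ I := by
  refine ⟨fun h => (subset_lSpan S).trans h, fun h a => ?_⟩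
  rintro ⟨d, hd, had⟩
  refine hI a d (by rwa [abs_of_nonneg (nonneg_of_mem_closure_abs hd)]) ?_
  have : AddSubmonoid.closure (abs '' S) ≤ I.toAddSubmonoid := by
    rw [AddSubmonoid.closure_le]
    rintro _ ⟨b, hb, rfl⟩
    exact hI.abs_mem A.isBAL (h hb)
  exact this hd

theorem exists_ideal_le {I : Ideal A} (hI : IsLIdeal I) (hI' : I ≠ ⊤) :
    ∃ M : A.Yosida, I ≤ M.ideal := by
  obtain ⟨M, hIM, hM⟩ := zorn_le_nonempty₀ {I : Ideal A | IsLIdeal I ∧ I ≠ ⊤} (by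
    intro c hc hchain J hJ
    have hdir : DirectedOn (· ≤ ·) c := hchain.directedOn
    have hmem : ∀ x : A, x ∈ sSup c ↔ ∃ K ∈ c, x ∈ K :=
      fun x => Submodule.mem_sSup_of_directed ⟨J, hJ⟩ hdir
    refine ⟨sSup c, ⟨?_, ?_⟩, fun K hK => le_sSup hK⟩
    · intro a b hab hb
      obtain ⟨K, hK, hbK⟩ := (hmem b).mp hb
      exact (hmem a).mpr ⟨K, hK, (hc hK).1 a b hab hbK⟩
    · rw [Ne, Ideal.eq_top_iff_one, hmem]
      rintro ⟨K, hK, h1⟩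
      exact (hc hK).2 ((Ideal.eq_top_iff_one K).mpr h1)) I ⟨hI, hI'⟩
  exact ⟨⟨M, hM⟩, hIM⟩

/-- Unless the positive combinations of absolute values of elements of `S` dominate `1`, some
maximal `ℓ`-ideal contains `S`. -/
theorem exists_subset_ideal {S : Set A}
    (h : ∀ d ∈ AddSubmonoid.closure (abs '' S), ¬ (1 : A) ≤ d) :
    ∃ M : A.Yosida, S ⊆ M.ideal := by
  obtain ⟨M, hM⟩ := exists_ideal_le (isLIdeal_lSpan S) (by
    rw [Ne, Ideal.eq_top_iff_one]
    rintro ⟨d, hd, h1⟩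
    exact h d hd ((le_abs_self 1).trans h1))
  exact ⟨M, (subset_lSpan S).trans hM⟩

/-! ### The real number attached to an element at a maximal `ℓ`-ideal -/

namespace Yosida

variable (M : A.Yosida)

theorem isLIdeal : IsLIdeal M.ideal := M.isMaximal.prop.1

theorem not_one_le {a : A} (ha : a ∈ M.ideal) : ¬ (1 : A) ≤ a :=
  M.isLIdeal.ne_top_iff.mp M.isMaximal.prop.2 a ha

@[ext]
theorem ext {M N : A.Yosida} (h : M.ideal = N.ideal) : M = N := by
  cases M; cases N; congr

theorem eq_of_le {M N : A.Yosida} (h : M.ideal ≤ N.ideal) : M = N :=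
  ext (M.isMaximal.eq_of_le N.isMaximal.prop h)

theorem eq_zero_of_algebraMap_mem {r : ℝ} (h : algebraMap ℝ A r ∈ M.ideal) : r = 0 := by
  by_contra hr
  have h1 : algebraMap ℝ A r⁻¹ * algebraMap ℝ A r ∈ M.ideal := M.ideal.mul_mem_left _ h
  rw [← map_mul, inv_mul_cancel₀ hr, map_one] at h1
  exact M.not_one_le h1 le_rfl

/-- Maximal `ℓ`-ideals are prime and `a⁺ * a⁻ = 0`; thus the quotient by `M` is totally ordered. -/
theorem posPart_mem_or_negPart_mem (a : A) : a⁺ ∈ M.ideal ∨ a⁻ ∈ M.ideal := by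
  refine M.isMaximal.mem_or_mem A.isBAL ?_
  rw [abs_of_nonneg (posPart_nonneg a), abs_of_nonneg (negPart_nonneg a), posPart_mul_negPart]
  exact M.ideal.zero_mem

/-- The real number is the infimum of the `r` with `a ≤ r` modulo `M`. Up to elements of `M`, `|a -
sInf S|` is below every `ε > 0`, whereas outside `M` some multiple of it would dominate `1` modulo
`M`. -/
theorem exists_sub_mem (a : A) : ∃ r : ℝ, a - algebraMap ℝ A r ∈ M.ideal := by
  set S : Set ℝ := {r | (a - algebraMap ℝ A r)⁺ ∈ M.ideal} with hS
  have hne : S.Nonempty := by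
    obtain ⟨r, hr⟩ := exists_le_algebraMap a
    refine ⟨r, ?_⟩
    rw [hS, Set.mem_ofPred_eq, posPart_eq_zero.mpr (sub_nonpos.mpr hr)]
    exact M.ideal.zero_mem
  have hbdd : BddBelow S := by
    obtain ⟨r, hr⟩ := exists_le_algebraMap (-a)
    -- The extra `1` makes `a - s ≥ 1` for `s` below this bound, which contradicts properness of
    -- `M`.
    refine ⟨-r - 1, fun s hs => ?_⟩
    by_contra hlt
    refine M.not_one_le hs (le_trans ?_ (le_posPart _))
    have h1 : algebraMap ℝ A s ≤ algebraMap ℝ A (-r - 1) := algebraMap_mono A (by linarith)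
    rw [map_sub, map_neg, map_one] at h1
    have h2 := neg_le_neg hr
    rw [neg_neg] at h2
    rw [le_sub_iff_add_le]
    calc 1 + algebraMap ℝ A s ≤ 1 + (-algebraMap ℝ A r - 1) := by gcongr
      _ = -algebraMap ℝ A r := by ring
      _ ≤ a := h2
  have hlow : ∀ ε > 0, (a - algebraMap ℝ A (sInf S - ε))⁻ ∈ M.ideal := fun ε hε =>
    (M.posPart_mem_or_negPart_mem _).resolve_left fun h => by
      have := csInf_le hbdd (show sInf S - ε ∈ S from h)
      linarith
  have hup : ∀ ε > 0, (a - algebraMap ℝ A (sInf S + ε))⁺ ∈ M.ideal := by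
    intro ε hε
    obtain ⟨s, hs, hlt⟩ := exists_lt_of_csInf_lt hne (show sInf S < sInf S + ε by linarith)
    refine M.isLIdeal.mem_of_le (posPart_nonneg _) ?_ hs
    exact sup_le_sup_right (sub_le_sub_left (algebraMap_mono A hlt.le) a) 0
  refine ⟨sInf S, ?_⟩
  by_contra hcon
  obtain ⟨m, hm, n, h⟩ := M.isMaximal.exists_one_le A.isBAL hcon
  -- Chosen so that `n * ε ≤ 1 / 2`, also for `n = 0`; half of the `1` then remains below an element
  -- of `M`.
  set ε : ℝ := (2 * (n + 1))⁻¹ with hε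
  have hεpos : 0 < ε := by positivity
  set x := (a - algebraMap ℝ A (sInf S + ε))⁺
  set y := (a - algebraMap ℝ A (sInf S - ε))⁻
  have hx : x ∈ M.ideal := hup ε hεpos
  have hy : y ∈ M.ideal := hlow ε hεpos
  have hx0 : 0 ≤ x := posPart_nonneg _
  have hy0 : 0 ≤ y := negPart_nonneg _
  have h1 : |a - algebraMap ℝ A (sInf S)| ≤ algebraMap ℝ A ε + (x + y) := by
    refine sup_le ?_ ?_
    · have : a - algebraMap ℝ A (sInf S + ε) ≤ x := le_posPart _
      rw [map_add] at this
      calc a - algebraMap ℝ A (sInf S)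
          = algebraMap ℝ A ε + (a - (algebraMap ℝ A (sInf S) + algebraMap ℝ A ε)) := by ring
        _ ≤ algebraMap ℝ A ε + (x + y) := by gcongr; exact this.trans (le_add_of_nonneg_right hy0)
    · have : -(a - algebraMap ℝ A (sInf S - ε)) ≤ y := neg_le_negPart _
      rw [map_sub] at this
      calc -(a - algebraMap ℝ A (sInf S))
          = algebraMap ℝ A ε + -(a - (algebraMap ℝ A (sInf S) - algebraMap ℝ A ε)) := by ring
        _ ≤ algebraMap ℝ A ε + (x + y) := by gcongr; exact this.trans (le_add_of_nonneg_left hx0)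
  have h2 : (1 : A) ≤ algebraMap ℝ A (1 / 2) + (m + n • (x + y)) := by
    calc (1 : A) ≤ m + n • (algebraMap ℝ A ε + (x + y)) :=
          h.trans (by gcongr)
      _ = algebraMap ℝ A (n * ε) + (m + n • (x + y)) := by
          rw [smul_add, map_mul, map_natCast, nsmul_eq_mul, nsmul_eq_mul]; ring
      _ ≤ _ := by
          gcongr
          rw [hε, mul_inv, ← mul_assoc, mul_comm, ← mul_assoc, one_div]
          have : ((n : ℝ) + 1)⁻¹ * n ≤ 1 := by
            rw [inv_mul_le_iff₀ (by positivity)]; linarith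
          nlinarith
  have h3 : algebraMap ℝ A (1 / 2) ≤ m + n • (x + y) := by
    have h4 : algebraMap ℝ A (1 / 2) = 1 - algebraMap ℝ A (1 / 2) := by
      rw [← map_one (algebraMap ℝ A), ← map_sub]; norm_num
    rw [h4, sub_le_iff_le_add']
    exact h2
  have hmem : m + n • (x + y) ∈ M.ideal :=
    M.ideal.add_mem hm (M.ideal.nsmul_mem (M.ideal.add_mem hx hy) n)
  have h5 := M.eq_zero_of_algebraMap_mem
    (M.isLIdeal.mem_of_le (algebraMap_nonneg A (by norm_num)) h3 hmem)
  norm_num at h5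

theorem existsUnique_sub_mem (a : A) : ∃! r : ℝ, a - algebraMap ℝ A r ∈ M.ideal := by
  obtain ⟨r, hr⟩ := M.exists_sub_mem a
  refine ⟨r, hr, fun s hs => ?_⟩
  have h := M.ideal.sub_mem hr hs
  rw [sub_sub_sub_cancel_left, ← map_sub] at h
  exact sub_eq_zero.mp (M.eq_zero_of_algebraMap_mem h)

/-- The homomorphism `A → A / M ≅ ℝ`. -/
noncomputable def val : A →ₐ[ℝ] ℝ where
  toFun a := (M.exists_sub_mem a).choose
  map_one' := (M.existsUnique_sub_mem 1).unique (M.exists_sub_mem 1).choose_spec (by simp)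
  map_zero' := (M.existsUnique_sub_mem 0).unique (M.exists_sub_mem 0).choose_spec (by simp)
  map_add' a b := (M.existsUnique_sub_mem _).unique (M.exists_sub_mem _).choose_spec (by
    have := M.ideal.add_mem (M.exists_sub_mem a).choose_spec (M.exists_sub_mem b).choose_spec
    rwa [sub_add_sub_comm, ← map_add] at this)
  map_mul' a b := (M.existsUnique_sub_mem _).unique (M.exists_sub_mem _).choose_spec (by
    have := M.ideal.add_mem (M.ideal.mul_mem_right b (M.exists_sub_mem a).choose_spec)
      (M.ideal.mul_mem_left (algebraMap ℝ A (M.exists_sub_mem a).choose)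
        (M.exists_sub_mem b).choose_spec)
    rwa [sub_mul, mul_sub, sub_add_sub_cancel, ← map_mul] at this)
  commutes' r := (M.existsUnique_sub_mem _).unique (M.exists_sub_mem _).choose_spec (by simp)

theorem sub_val_mem (a : A) : a - algebraMap ℝ A (M.val a) ∈ M.ideal :=
  (M.exists_sub_mem a).choose_spec

theorem val_eq_iff {a : A} {r : ℝ} : M.val a = r ↔ a - algebraMap ℝ A r ∈ M.ideal :=
  ⟨fun h => h ▸ M.sub_val_mem a, fun h => (M.existsUnique_sub_mem a).unique (M.sub_val_mem a) h⟩

theorem mem_ideal_iff {a : A} : a ∈ M.ideal ↔ M.val a = 0 := by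
  rw [val_eq_iff, map_zero, sub_zero]

@[simp]
theorem val_algebraMap (r : ℝ) : M.val (algebraMap ℝ A r) = r := M.val.commutes r

/-- Replacing `a` and `b` by their values changes the join by at most `|a - r| + |b - s|`, an
element of `M`. -/
theorem val_sup (a b : A) : M.val (a ⊔ b) = M.val a ⊔ M.val b := by
  rw [val_eq_iff, (algebraMap_mono A).map_sup]
  set r := algebraMap ℝ A (M.val a)
  set s := algebraMap ℝ A (M.val b)
  have h1 : |a ⊔ b - r ⊔ s| ≤ |a - r| + |b - s| := by
    calc |a ⊔ b - r ⊔ s| = |(a ⊔ b - r ⊔ b) + (r ⊔ b - r ⊔ s)| := by rw [sub_add_sub_cancel]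
      _ ≤ |a ⊔ b - r ⊔ b| + |r ⊔ b - r ⊔ s| := abs_add_le _ _
      _ ≤ |a - r| + |b - s| := by
        refine add_le_add (abs_sup_sub_sup_le_abs _ _ _) ?_
        rw [sup_comm r b, sup_comm r s]
        exact abs_sup_sub_sup_le_abs _ _ _
  refine M.isLIdeal _ _ (h1.trans (le_abs_self _)) ?_
  exact M.ideal.add_mem (M.isLIdeal.abs_mem A.isBAL (M.sub_val_mem a))
    (M.isLIdeal.abs_mem A.isBAL (M.sub_val_mem b))

theorem val_inf (a b : A) : M.val (a ⊓ b) = M.val a ⊓ M.val b := by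
  have h := M.val_sup (-a) (-b)
  rw [← neg_inf, map_neg, map_neg, map_neg, ← neg_inf] at h
  exact neg_injective h

theorem val_mono {a b : A} (h : a ≤ b) : M.val a ≤ M.val b := by
  rw [← sup_eq_right, ← val_sup, sup_eq_right.mpr h]

theorem val_abs (a : A) : M.val |a| = |M.val a| := by
  rw [abs, val_sup, map_neg]; rfl

theorem val_posPart (a : A) : M.val a⁺ = (M.val a)⁺ := by
  rw [posPart_def, val_sup, map_zero]; rfl

theorem val_negPart (a : A) : M.val a⁻ = (M.val a)⁻ := by
  rw [negPart_def, val_sup, map_zero, map_neg]; rfl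

end Yosida

/-- An `ℓ`-ideal with quotient `ℝ` is maximal. -/
theorem isMaximalLIdeal_of_exists_sub_mem {I : Ideal A} (hI : IsLIdeal I) (h1 : (1 : A) ∉ I)
    (h : ∀ a : A, ∃ r : ℝ, a - algebraMap ℝ A r ∈ I) : IsMaximalLIdeal I := by
  refine ⟨⟨hI, fun ht => h1 ((Ideal.eq_top_iff_one I).mp ht)⟩, fun J hJ hIJ a ha => ?_⟩
  obtain ⟨r, hr⟩ := h a
  by_cases h0 : r = 0
  · simpa [h0] using hr
  · exfalso
    have h2 := J.sub_mem ha (hIJ hr)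
    rw [sub_sub_cancel] at h2
    have h3 := J.mul_mem_left (algebraMap ℝ A r⁻¹) h2
    rw [← map_mul, inv_mul_cancel₀ h0, map_one] at h3
    exact hJ.2 ((Ideal.eq_top_iff_one J).mpr h3)

/-- By the archimedean axiom it is enough that `b = n • a⁻ - 1` has `b⁺ = 0` for every `n`. At each
point `a⁻` vanishes and `b⁻` is `1`, so `b⁻` lies in no maximal `ℓ`-ideal and `1 ≤ k • b⁻` for some
`k`. Multiplying by `b⁺` gives `b⁺ ≤ 0`. -/
theorem nonneg_of_val_nonneg {a : A} (h : ∀ M : A.Yosida, 0 ≤ M.val a) : 0 ≤ a := by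
  have key : ∀ n : ℕ, n • a⁻ ≤ 1 := by
    intro n
    set b : A := n • a⁻ - 1 with hb
    rw [← sub_nonpos, ← hb, ← posPart_eq_zero]
    by_cases htop : lSpan {b⁻} = ⊤
    · obtain ⟨d, hd, h1⟩ : (1 : A) ∈ lSpan {b⁻} := by rw [htop]; trivial
      rw [Set.image_singleton, AddSubmonoid.mem_closure_singleton] at hd
      obtain ⟨k, rfl⟩ := hd
      have h1 : (1 : A) ≤ k • |b⁻| := (le_abs_self 1).trans h1
      rw [abs_of_nonneg (negPart_nonneg b)] at h1
      have h2 := mul_le_mul_of_nonneg_left h1 (posPart_nonneg b)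
      rw [mul_one, mul_smul_comm, posPart_mul_negPart, smul_zero] at h2
      exact le_antisymm h2 (posPart_nonneg b)
    · obtain ⟨M, hM⟩ := exists_ideal_le (isLIdeal_lSpan _) htop
      exfalso
      have h1 := M.mem_ideal_iff.mp (hM (subset_lSpan _ rfl))
      have h2 : M.val b = -1 := by
        rw [hb, map_sub, map_nsmul, M.val_negPart, negPart_eq_zero.mpr (h M)]
        simp
      rw [M.val_negPart, h2] at h1
      norm_num [negPart_def] at h1
  exact negPart_nonpos.mp (A.isBAL.archimedean _ _ key)

theorem le_iff_val_le {a b : A} : a ≤ b ↔ ∀ M : A.Yosida, M.val a ≤ M.val b := by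
  refine ⟨fun h M => M.val_mono h, fun h => sub_nonneg.mp (nonneg_of_val_nonneg fun M => ?_)⟩
  rw [map_sub, sub_nonneg]
  exact h M

theorem eq_iff_val_eq {a b : A} : a = b ↔ ∀ M : A.Yosida, M.val a = M.val b :=
  ⟨fun h _ => h ▸ rfl, fun h => le_antisymm (le_iff_val_le.mpr fun M => (h M).le)
    (le_iff_val_le.mpr fun M => (h M).ge)⟩

end MBAL

/-! ### The topology of the Yosida space -/

namespace MBAL

variable {A B : MBAL.{u}}

theorem isClosed_iff {F : Set A.Yosida} :
    IsClosed F ↔ ∃ I : Ideal A, IsLIdeal I ∧ F = A.zeroSet I := by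
  rw [← isOpen_compl_iff]
  change Fᶜᶜ ∈ {F | ∃ I : Ideal A, IsLIdeal I ∧ F = A.zeroSet I} ↔ _
  rw [compl_compl]
  rfl

theorem mem_zeroSet_iff {I : Ideal A} {M : A.Yosida} :
    M ∈ A.zeroSet I ↔ ∀ a ∈ I, M.val a = 0 :=
  forall₂_congr fun _ _ => M.mem_ideal_iff

theorem isClosed_val_eq_zero (a : A) : IsClosed {M : A.Yosida | M.val a = 0} := by
  refine isClosed_iff.mpr ⟨lSpan {a}, isLIdeal_lSpan _, ?_⟩
  ext M
  change M.val a = 0 ↔ lSpan {a} ≤ M.ideal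
  rw [lSpan_le M.isLIdeal, Set.singleton_subset_iff, SetLike.mem_coe, M.mem_ideal_iff]

theorem isClosed_val_le (a : A) (r : ℝ) : IsClosed {M : A.Yosida | M.val a ≤ r} := by
  convert isClosed_val_eq_zero (a - algebraMap ℝ A r)⁺ using 3 with M
  rw [M.val_posPart, posPart_eq_zero, map_sub, M.val_algebraMap, sub_nonpos]

theorem continuous_val (a : A) : Continuous fun M : A.Yosida => M.val a := by
  rw [OrderTopology.continuous_iff]
  intro r
  constructor
  · rw [← isClosed_compl_iff]
    convert isClosed_val_le a r using 1
    ext M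
    simp
  · rw [← isClosed_compl_iff]
    convert isClosed_val_le (-a) (-r) using 1
    ext M
    simp

/-- Each closed set `Z(I)` is an intersection of zero sets of single elements; with
`continuous_val`, the topology of `Y_A` is initial for the evaluations. -/
theorem continuous_of_continuous_val {X : Type*} [TopologicalSpace X] {f : X → A.Yosida}
    (hf : ∀ a : A, Continuous fun x => (f x).val a) : Continuous f := by
  refine continuous_iff_isClosed.mpr fun F hF => ?_
  obtain ⟨I, -, rfl⟩ := isClosed_iff.mp hF
  have : f ⁻¹' A.zeroSet I = ⋂ a ∈ I, {x | (f x).val a = 0} := by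
    ext x
    simp [mem_zeroSet_iff]
  rw [this]
  exact isClosed_biInter fun a _ => isClosed_eq (hf a) continuous_const

theorem eq_of_val_eq {M N : A.Yosida} (h : ∀ a : A, M.val a = N.val a) : M = N :=
  Yosida.ext (Ideal.ext fun a => by rw [M.mem_ideal_iff, N.mem_ideal_iff, h])

theorem exists_val_ne {M N : A.Yosida} (h : M ≠ N) : ∃ a : A, M.val a ≠ N.val a := by
  by_contra! hcon
  exact h (eq_of_val_eq hcon)

instance : T2Space A.Yosida := by
  refine ⟨fun M N h => ?_⟩
  obtain ⟨a, ha⟩ := exists_val_ne h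
  exact separated_by_continuous (continuous_val a) ha

/-- If the `Z(I i)` have empty intersection, some sum of absolute values from the `I i` dominates
`1`, and it involves only finitely many of the ideals. -/
instance : CompactSpace A.Yosida := by
  refine ⟨isCompact_of_finite_subfamily_closed fun {ι} t ht hempty => ?_⟩
  choose I hI hIt using fun i => isClosed_iff.mp (ht i)
  rw [Set.univ_inter] at hempty
  obtain ⟨d, hd, h1⟩ : ∃ d ∈ AddSubmonoid.closure (abs '' ⋃ i, (I i : Set A)), (1 : A) ≤ d := by
    by_contra! hcon
    obtain ⟨M, hM⟩ := exists_subset_ideal hcon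
    have : M ∈ ⋂ i, t i := by
      rw [Set.mem_iInter]
      intro i
      rw [hIt]
      exact (Set.subset_iUnion (fun i => (I i : Set A)) i).trans hM
    rw [hempty] at this
    exact this
  have hd' : d ∈ ⨆ i, I i := by
    have : AddSubmonoid.closure (abs '' ⋃ i, (I i : Set A)) ≤ (⨆ i, I i).toAddSubmonoid := by
      rw [AddSubmonoid.closure_le]
      rintro _ ⟨a, ha, rfl⟩
      obtain ⟨i, hi⟩ := Set.mem_iUnion.mp ha
      exact (le_iSup I i) ((hI i).abs_mem A.isBAL hi)
    exact this hd
  obtain ⟨s, hs⟩ := Submodule.mem_iSup_iff_exists_finset.mp hd'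
  refine ⟨s, ?_⟩
  rw [Set.univ_inter, Set.eq_empty_iff_forall_notMem]
  intro M hM
  have hle : ⨆ i ∈ s, I i ≤ M.ideal := iSup₂_le fun i hi => by
    have := Set.mem_iInter₂.mp hM i hi
    rwa [hIt] at this
  exact M.not_one_le (hle hs) h1

/-! ### The relation on the Yosida space -/

namespace Yosida

variable (x : A.Yosida)

theorem val_box_inf (a b : A) :
    x.val (A.box (a ⊓ b)) = x.val (A.box a) ⊓ x.val (A.box b) := by
  rw [A.isModal.box_inf, val_inf]

theorem val_box_mono {a b : A} (h : a ≤ b) : x.val (A.box a) ≤ x.val (A.box b) := by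
  rw [← inf_eq_left.mpr h, val_box_inf]
  exact inf_le_right

/-- Scaling by `0` gives `□0 = □0 * □a`, and a nonzero value of `□0` cancels. -/
theorem val_box_eq_one {a : A} (h : x.val (A.box 0) ≠ 0) : x.val (A.box a) = 1 := by
  have h1 := congrArg x.val (A.isModal.box_smul a 0 le_rfl)
  rw [zero_smul, map_zero, map_mul] at h1
  exact (mul_eq_left₀ h).mp h1.symm

variable {x}

theorem val_box_algebraMap (h0 : x.val (A.box 0) = 0) (r : ℝ) :
    x.val (A.box (algebraMap ℝ A r)) = r := by
  rw [A.isModal.box_const]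
  simp [h0]

theorem val_box_add (h0 : x.val (A.box 0) = 0) (a : A) (r : ℝ) :
    x.val (A.box (a + algebraMap ℝ A r)) = x.val (A.box a) + r := by
  rw [A.isModal.box_add_const, map_sub, map_add, val_box_algebraMap h0, h0, sub_zero]

theorem val_box_smul (h0 : x.val (A.box 0) = 0) (a : A) {r : ℝ} (hr : 0 ≤ r) :
    x.val (A.box (r • a)) = r * x.val (A.box a) := by
  rw [A.isModal.box_smul a r hr, map_mul, val_box_algebraMap h0]

theorem val_box_posPart (a : A) : x.val (A.box a⁺) = x.val (A.box a) ⊔ 0 := by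
  rw [posPart_def, A.isModal.box_pos, val_sup, map_zero]

/-- If `□ a ∈ x` for all `0 ≤ a ∈ I`, then some `R_□`-successor of `x` contains `I`. -/
theorem exists_rel_of_box_mem {I : Ideal A} (hI : IsLIdeal I)
    (h : ∀ a ∈ I, 0 ≤ a → x.val (A.box a) = 0) : ∃ y : A.Yosida, A.yosidaRel x y ∧ I ≤ y.ideal := by
  have h0 : x.val (A.box 0) = 0 := h 0 I.zero_mem le_rfl
  -- Containing `c⁻` means `c(y) ≥ 0`. Asking this of all `c` with `(□c)(x) = 0` amounts, after
  -- subtracting constants, to `(□a)(x) ≤ a(y)` for all `a`.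
  obtain ⟨y, hy⟩ := exists_subset_ideal
      (S := (I : Set A) ∪ {b | ∃ c : A, x.val (A.box c) = 0 ∧ b = c⁻}) (by
    intro d hd h1
    -- As `□` preserves meets, the elements `c` merge into one: `c ⊓ c'` still has box zero at `x`,
    -- and its negative part dominates both.
    have hbound : ∃ b ∈ I, 0 ≤ b ∧ ∃ c : A, x.val (A.box c) = 0 ∧ ∃ k : ℕ, d ≤ b + k • c⁻ := by
      clear h1
      induction hd using AddSubmonoid.closure_induction with
      | mem d hd =>
        obtain ⟨e, he | ⟨c, hc, rfl⟩, rfl⟩ := hd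
        · exact ⟨|e|, hI.abs_mem A.isBAL he, abs_nonneg e, 0, h0, 0, by simp⟩
        · exact ⟨0, I.zero_mem, le_rfl, c, hc, 1, by simp [abs_of_nonneg (negPart_nonneg c)]⟩
      | zero => exact ⟨0, I.zero_mem, le_rfl, 0, h0, 0, by simp⟩
      | add d e _ _ hd he =>
        obtain ⟨b, hb, hb0, c, hc, k, hk⟩ := hd
        obtain ⟨b', hb', hb0', c', hc', k', hk'⟩ := he
        refine ⟨b + b', I.add_mem hb hb', add_nonneg hb0 hb0', c ⊓ c', ?_, k + k', ?_⟩
        · rw [val_box_inf, hc, hc', inf_idem]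
        · have h2 : c⁻ ≤ (c ⊓ c')⁻ := negPart_anti inf_le_left
          have h3 : c'⁻ ≤ (c ⊓ c')⁻ := negPart_anti inf_le_right
          calc d + e ≤ (b + k • c⁻) + (b' + k' • c'⁻) := add_le_add hk hk'
            _ ≤ (b + k • (c ⊓ c')⁻) + (b' + k' • (c ⊓ c')⁻) := by gcongr
            _ = _ := by rw [add_smul]; abel
    obtain ⟨b, hb, hb0, c, hc, k, hk⟩ := hbound
    -- Applying `□` at `x` to this inequality yields `1 ≤ 0`.
    have h2 : (k : ℝ) • (c ⊓ 0) + algebraMap ℝ A 1 ≤ b := by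
      have h3 : c⁻ = -(c ⊓ 0) := by rw [negPart_def, neg_inf, neg_zero]
      have h4 := h1.trans hk
      rw [h3, smul_neg, ← sub_eq_add_neg, le_sub_iff_add_le] at h4
      rwa [Nat.cast_smul_eq_nsmul, map_one, add_comm]
    have h5 := x.val_box_mono h2
    rw [val_box_add h0, val_box_smul h0 _ (Nat.cast_nonneg k), val_box_inf, hc, h0, h b hb hb0] at h5
    norm_num at h5)
  refine ⟨y, fun a ha ha0 => ?_, fun a ha => hy (Or.inl ha)⟩
  rw [mem_ideal_iff]
  have h1 : x.val (A.box (a + algebraMap ℝ A (-x.val (A.box a)))) = 0 := by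
    rw [val_box_add h0, add_neg_cancel]
  have h2 : (a + algebraMap ℝ A (-x.val (A.box a)))⁻ ∈ y.ideal := hy (Or.inr ⟨_, h1, rfl⟩)
  rw [mem_ideal_iff, val_negPart, negPart_eq_zero, map_add, val_algebraMap,
    y.mem_ideal_iff.mp ha, zero_add, neg_nonneg] at h2
  have h3 := x.val_box_mono ha0
  rw [h0] at h3
  exact le_antisymm h2 h3

theorem val_box_zero_of_rel {y : A.Yosida} (h : A.yosidaRel x y) : x.val (A.box 0) = 0 :=
  x.mem_ideal_iff.mp (h 0 y.ideal.zero_mem le_rfl)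

/-- The element `(a - a(y))⁺` lies in `y`, and its box at `x` is `((□a)(x) - a(y))⁺`, which must
vanish. -/
theorem val_box_le_of_rel {y : A.Yosida} (h : A.yosidaRel x y) (a : A) :
    x.val (A.box a) ≤ y.val a := by
  have h0 := val_box_zero_of_rel h
  have h1 : (a + algebraMap ℝ A (-y.val a))⁺ ∈ y.ideal := by
    rw [mem_ideal_iff, val_posPart, map_add, val_algebraMap, add_neg_cancel, posPart_zero]
  have h2 := x.mem_ideal_iff.mp (h _ h1 (posPart_nonneg _))
  rw [val_box_posPart, sup_eq_right, val_box_add h0] at h2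
  linarith

theorem rel_iff {y : A.Yosida} :
    A.yosidaRel x y ↔ x.val (A.box 0) = 0 ∧ ∀ a : A, x.val (A.box a) ≤ y.val a := by
  refine ⟨fun h => ⟨val_box_zero_of_rel h, val_box_le_of_rel h⟩, fun h a ha ha0 => ?_⟩
  rw [mem_ideal_iff]
  refine le_antisymm ((h.2 a).trans_eq (y.mem_ideal_iff.mp ha)) ?_
  rw [← h.1]
  exact x.val_box_mono ha0

/-- The infimum over successors is attained: a successor containing `(a - (□a)(x))⁺` satisfies `a(y)
≤ (□a)(x)`. -/
theorem exists_rel_val_eq (h0 : x.val (A.box 0) = 0) (a : A) :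
    ∃ y : A.Yosida, A.yosidaRel x y ∧ y.val a = x.val (A.box a) := by
  set c : A := a + algebraMap ℝ A (-x.val (A.box a)) with hc
  have hc0 : x.val (A.box c) = 0 := by rw [val_box_add h0, add_neg_cancel]
  obtain ⟨y, hxy, hy⟩ := exists_rel_of_box_mem (x := x) (isLIdeal_lSpan {c⁺}) (by
    rintro b ⟨d, hd, hbd⟩ hb
    rw [Set.image_singleton, AddSubmonoid.mem_closure_singleton] at hd
    obtain ⟨k, rfl⟩ := hd
    rw [abs_of_nonneg hb, abs_of_nonneg (posPart_nonneg c), ← Nat.cast_smul_eq_nsmul ℝ] at hbd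
    refine le_antisymm ?_ (h0 ▸ x.val_box_mono hb)
    refine (x.val_box_mono hbd).trans_eq ?_
    rw [val_box_smul h0 _ (Nat.cast_nonneg k), val_box_posPart, hc0, sup_idem, mul_zero])
  refine ⟨y, hxy, le_antisymm ?_ (val_box_le_of_rel hxy a)⟩
  have h1 : c⁺ ∈ y.ideal := hy (subset_lSpan _ rfl)
  rw [mem_ideal_iff, val_posPart, posPart_eq_zero, hc, map_add, val_algebraMap] at h1
  linarith

end Yosida

theorem isContinuousRel_yosidaRel (A : MBAL.{u}) : IsContinuousRel A.yosidaRel where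
  isClosed_image x := by
    by_cases h0 : x.val (A.box 0) = 0
    · have : relImage A.yosidaRel x = ⋂ a : A, {y | x.val (A.box a) ≤ y.val a} := by
        ext y
        simp [relImage, Yosida.rel_iff, h0]
      rw [this]
      exact isClosed_iInter fun a => isClosed_le continuous_const (continuous_val a)
    · have : relImage A.yosidaRel x = ∅ := by
        ext y
        simp [relImage, Yosida.rel_iff, h0]
      rw [this]
      exact isClosed_empty
  isClosed_preimage F hF := by
    obtain ⟨I, hI, rfl⟩ := isClosed_iff.mp hF
    have : relPreimage A.yosidaRel (A.zeroSet I)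
        = ⋂ a ∈ {a : A | a ∈ I ∧ 0 ≤ a}, {x | x.val (A.box a) = 0} := by
      ext x
      simp only [Set.mem_iInter]
      constructor
      · rintro ⟨y, hy, hxy⟩ a ⟨ha, ha0⟩
        exact x.mem_ideal_iff.mp (hxy a (hy ha) ha0)
      · intro h
        obtain ⟨y, hxy, hy⟩ := Yosida.exists_rel_of_box_mem hI fun a ha ha0 => h a ⟨ha, ha0⟩
        exact ⟨y, hy, hxy⟩
    rw [this]
    exact isClosed_biInter fun a _ => isClosed_val_eq_zero _
  isOpen_preimage U hU := by
    obtain ⟨I, hI, hIU⟩ := isClosed_iff.mp hU.isClosed_compl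
    -- A point is in `U` exactly when `-|a|` is negative there for some `a ∈ I`. As minima over
    -- successors are attained, this can be read off from `□(-|a|)` at `x`.
    have : relPreimage A.yosidaRel U = ⋃ a ∈ I, {x | x.val (A.box (-|a|)) < 0} := by
      ext x
      simp only [Set.mem_iUnion]
      constructor
      · rintro ⟨y, hyU, hxy⟩
        have hy : ¬ I ≤ y.ideal := by
          change y ∉ A.zeroSet I
          rw [← hIU]
          exact fun h => h hyU
        obtain ⟨a, ha, hay⟩ := SetLike.not_le_iff_exists.mp hy
        refine ⟨a, ha, (Yosida.val_box_le_of_rel hxy _).trans_lt ?_⟩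
        rw [map_neg, y.val_abs, neg_lt_zero, abs_pos]
        exact fun h => hay (y.mem_ideal_iff.mpr h)
      · rintro ⟨a, ha, hax⟩
        -- Where `□0` does not vanish, `□(-|a|)` is `1`, not negative.
        have h0 : x.val (A.box 0) = 0 := by
          by_contra h
          have h1 : x.val (A.box (-|a|)) < 0 := hax
          rw [x.val_box_eq_one h] at h1
          norm_num at h1
        obtain ⟨y, hxy, hy⟩ := Yosida.exists_rel_val_eq h0 (-|a|)
        refine ⟨y, ?_, hxy⟩
        by_contra hyU
        have h2 : y ∈ A.zeroSet I := by rw [← hIU]; exact hyU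
        have h3 : x.val (A.box (-|a|)) < 0 := hax
        rw [← hy, map_neg, y.val_abs, mem_zeroSet_iff.mp h2 a ha] at h3
        norm_num at h3
    rw [this]
    exact isOpen_biUnion fun a _ => isOpen_lt (continuous_val _) continuous_const

/-! ### Functoriality of the Yosida space -/

namespace Hom

variable (α : A ⟶ B)

theorem map_abs (a : A) : α.toAlgHom |a| = |α.toAlgHom a| := by
  rw [abs, α.map_sup, map_neg]; rfl

theorem map_mono {a b : A} (h : a ≤ b) : α.toAlgHom a ≤ α.toAlgHom b := by
  rw [← sup_eq_right, ← α.map_sup, sup_eq_right.mpr h]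

theorem isMaximalLIdeal_comap (M : B.Yosida) :
    IsMaximalLIdeal (M.ideal.comap α.toAlgHom) := by
  refine isMaximalLIdeal_of_exists_sub_mem (fun a b hab hb => ?_) (fun h => ?_) fun a => ?_
  · refine M.isLIdeal _ _ ?_ (Ideal.mem_comap.mp hb)
    rw [← map_abs, ← map_abs]
    exact map_mono α hab
  · rw [Ideal.mem_comap, map_one] at h
    exact M.not_one_le h le_rfl
  · refine ⟨M.val (α.toAlgHom a), ?_⟩
    rw [Ideal.mem_comap, map_sub, AlgHom.commutes]
    exact M.sub_val_mem _

/-- The map `M ↦ α⁻¹(M)` of Yosida spaces. -/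
def comap (M : B.Yosida) : A.Yosida := ⟨M.ideal.comap α.toAlgHom, isMaximalLIdeal_comap α M⟩

theorem val_comap (M : B.Yosida) (a : A) : (comap α M).val a = M.val (α.toAlgHom a) := by
  rw [Yosida.val_eq_iff]
  change α.toAlgHom _ ∈ M.ideal
  rw [map_sub, AlgHom.commutes]
  exact M.sub_val_mem _

theorem continuous_comap : Continuous (comap α) :=
  continuous_of_continuous_val fun a => by
    simpa only [val_comap] using continuous_val (α.toAlgHom a)

/-- For the back condition, each nonnegative element of the `ℓ`-ideal generated by `α(z)` lies below
some `α(a)` with `0 ≤ a ∈ z`, so its box vanishes at `x`. A successor `y` containing this ideal has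
`z ⊆ α⁻¹(y)`, and maximality of `z` gives equality. -/
theorem isBoundedMorphism_comap : IsBoundedMorphism B.yosidaRel A.yosidaRel (comap α) := by
  intro x
  ext z
  constructor
  · rintro ⟨y, hxy, rfl⟩ a ha ha0
    change α.toAlgHom (A.box a) ∈ x.ideal
    rw [α.map_box]
    refine hxy _ ha ?_
    simpa using map_mono α ha0
  · intro hz
    obtain ⟨y, hxy, hy⟩ := Yosida.exists_rel_of_box_mem (x := x)
        (isLIdeal_lSpan (α.toAlgHom '' z.ideal)) (by
      rintro b ⟨d, hd, hbd⟩ hb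
      obtain ⟨a, ha, ha0, hda⟩ : ∃ a ∈ z.ideal, 0 ≤ a ∧ d = α.toAlgHom a := by
        clear hbd
        induction hd using AddSubmonoid.closure_induction with
        | mem d hd =>
          obtain ⟨_, ⟨a, ha, rfl⟩, rfl⟩ := hd
          exact ⟨|a|, z.isLIdeal.abs_mem A.isBAL ha, abs_nonneg a, (map_abs α a).symm⟩
        | zero => exact ⟨0, z.ideal.zero_mem, le_rfl, (map_zero _).symm⟩
        | add d e _ _ hd he =>
          obtain ⟨a, ha, ha0, rfl⟩ := hd
          obtain ⟨b, hb, hb0, rfl⟩ := he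
          exact ⟨a + b, z.ideal.add_mem ha hb, add_nonneg ha0 hb0, (map_add _ _ _).symm⟩
      rw [abs_of_nonneg hb, hda] at hbd
      have h1 : ∀ c ∈ z.ideal, 0 ≤ c → x.val (B.box (α.toAlgHom c)) = 0 := fun c hc hc0 => by
        rw [← α.map_box]
        exact x.mem_ideal_iff.mp (hz c hc hc0)
      have h0 := h1 0 z.ideal.zero_mem le_rfl
      rw [map_zero] at h0
      refine le_antisymm ((x.val_box_mono hbd).trans_eq (h1 a ha ha0)) ?_
      rw [← h0]
      exact x.val_box_mono hb)
    refine ⟨y, hxy, (Yosida.eq_of_le fun a ha => ?_).symm⟩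
    exact hy (subset_lSpan _ ⟨a, ha, rfl⟩)

end Hom

end MBAL

theorem yosidaWellDefined : YosidaWellDefined.{u} where
  compactSpace _ := inferInstance
  t2Space _ := inferInstance
  isContinuousRel := MBAL.isContinuousRel_yosidaRel
  isMaximal_comap _ _ := MBAL.Hom.isMaximalLIdeal_comap
  continuous_comap _ _ := MBAL.Hom.continuous_comap
  isBounded_comap _ _ := MBAL.Hom.isBoundedMorphism_comap

/-! ### The algebra of a compact Hausdorff frame -/

namespace KHK

variable (X : KHK.{u}) (f : C(X, ℝ)) {x : X}

theorem boxFun_of_isEmpty (h : ¬ (relImage X.rel x).Nonempty) : boxFun X f x = 1 := if_neg h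

theorem exists_boxFun_eq (h : (relImage X.rel x).Nonempty) :
    ∃ y, X.rel x y ∧ boxFun X f x = f y ∧ ∀ z, X.rel x z → f y ≤ f z := by
  obtain ⟨y, hy, hmin⟩ :=
    (X.isContinuousRel.isClosed_image x).isCompact.exists_isMinOn h f.continuous.continuousOn
  refine ⟨y, hy, ?_, fun z hz => hmin hz⟩
  rw [boxFun, if_pos h]
  exact IsLeast.csInf_eq ⟨⟨y, hy, rfl⟩, by rintro _ ⟨z, hz, rfl⟩; exact hmin hz⟩

theorem boxFun_eq_of_isLeast {y : X} (hy : X.rel x y) (h : ∀ z, X.rel x z → f y ≤ f z) :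
    boxFun X f x = f y := by
  rw [boxFun, if_pos ⟨y, hy⟩]
  exact IsLeast.csInf_eq ⟨⟨y, hy, rfl⟩, by rintro _ ⟨z, hz, rfl⟩; exact h z hz⟩

/-- Holds because the minimum over `R[x]` is attained. The conjunct `True` makes the right side
unfold to membership in `relPreimage X.rel Set.univ`. -/
theorem boxFun_le_iff {r : ℝ} : boxFun X f x ≤ r ↔
    (∃ y, f y ≤ r ∧ X.rel x y) ∨ ((¬ ∃ y, True ∧ X.rel x y) ∧ 1 ≤ r) := by
  by_cases h : (relImage X.rel x).Nonempty
  · obtain ⟨y, hy, he, hmin⟩ := X.exists_boxFun_eq f h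
    rw [he]
    refine ⟨fun hr => Or.inl ⟨y, hr, hy⟩, ?_⟩
    rintro (⟨z, hz, hxz⟩ | ⟨hn, -⟩)
    · exact (hmin z hxz).trans hz
    · exact absurd ⟨y, trivial, hy⟩ hn
  · rw [X.boxFun_of_isEmpty f h]
    refine ⟨fun hr => Or.inr ⟨fun ⟨y, _, hy⟩ => h ⟨y, hy⟩, hr⟩, ?_⟩
    rintro (⟨z, -, hxz⟩ | ⟨-, hr⟩)
    · exact absurd ⟨z, hxz⟩ h
    · exact hr

theorem boxFun_lt_iff {r : ℝ} : boxFun X f x < r ↔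
    (∃ y, f y < r ∧ X.rel x y) ∨ ((¬ ∃ y, True ∧ X.rel x y) ∧ 1 < r) := by
  by_cases h : (relImage X.rel x).Nonempty
  · obtain ⟨y, hy, he, hmin⟩ := X.exists_boxFun_eq f h
    rw [he]
    refine ⟨fun hr => Or.inl ⟨y, hr, hy⟩, ?_⟩
    rintro (⟨z, hz, hxz⟩ | ⟨hn, -⟩)
    · exact (hmin z hxz).trans_lt hz
    · exact absurd ⟨y, trivial, hy⟩ hn
  · rw [X.boxFun_of_isEmpty f h]
    refine ⟨fun hr => Or.inr ⟨fun ⟨y, _, hy⟩ => h ⟨y, hy⟩, hr⟩, ?_⟩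
    rintro (⟨z, -, hxz⟩ | ⟨-, hr⟩)
    · exact absurd ⟨z, hxz⟩ h
    · exact hr

/-- Closed preimages handle weak sublevel sets and open ones strict sublevel sets; the default value
`1` does no harm since `R⁻¹[X]` is clopen. -/
theorem continuous_boxFun : Continuous (boxFun X f) := by
  have hR := X.isContinuousRel
  rw [OrderTopology.continuous_iff]
  intro r
  constructor
  · rw [← isClosed_compl_iff]
    have : (boxFun X f ⁻¹' Set.Ioi r)ᶜ = relPreimage X.rel {y | f y ≤ r} ∪
        ((relPreimage X.rel Set.univ)ᶜ ∩ {_x | 1 ≤ r}) := by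
      ext x
      rw [Set.mem_compl_iff, Set.mem_preimage, Set.mem_Ioi, not_lt, boxFun_le_iff]
      rfl
    rw [this]
    exact (hR.isClosed_preimage _ (isClosed_le f.continuous continuous_const)).union
      ((hR.isOpen_preimage _ isOpen_univ).isClosed_compl.inter isClosed_const)
  · have : boxFun X f ⁻¹' Set.Iio r = relPreimage X.rel {y | f y < r} ∪
        ((relPreimage X.rel Set.univ)ᶜ ∩ {_x | 1 < r}) := by
      ext x
      rw [Set.mem_preimage, Set.mem_Iio, boxFun_lt_iff]
      rfl
    rw [this]
    exact (hR.isOpen_preimage _ (isOpen_lt f.continuous continuous_const)).union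
      ((hR.isClosed_preimage _ isClosed_univ).isOpen_compl.inter isOpen_const)

/-- Pointwise: without successors every box is `1`. Otherwise the operations on a single function
are monotone and keep its minimizer, and `f ⊓ g` is minimized where the smaller of the two minima is
attained. -/
theorem isModalOperator_boxFun :
    IsModalOperator (fun f : C(X, ℝ) => (⟨boxFun X f, X.continuous_boxFun f⟩ : C(X, ℝ))) where
  box_inf f g := by
    ext x
    change boxFun X (f ⊓ g) x = boxFun X f x ⊓ boxFun X g x
    by_cases h : (relImage X.rel x).Nonempty
    · obtain ⟨y, hy, hfy, hymin⟩ := X.exists_boxFun_eq f h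
      obtain ⟨z, hz, hgz, hzmin⟩ := X.exists_boxFun_eq g h
      rw [hfy, hgz]
      rcases le_total (f y) (g z) with hle | hle
      · have h1 : (f ⊓ g) y = f y := inf_eq_left.mpr (hle.trans (hzmin y hy))
        rw [X.boxFun_eq_of_isLeast _ hy, h1, inf_eq_left.mpr hle]
        exact fun w hw => h1.trans_le (le_inf (hymin w hw) (hle.trans (hzmin w hw)))
      · have h1 : (f ⊓ g) z = g z := inf_eq_right.mpr (hle.trans (hymin z hz))
        rw [X.boxFun_eq_of_isLeast _ hz, h1, inf_eq_right.mpr hle]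
        exact fun w hw => h1.trans_le (le_inf (hle.trans (hymin w hw)) (hzmin w hw))
    · simp only [X.boxFun_of_isEmpty _ h, inf_idem]
  box_const r := by
    ext x
    change boxFun X (algebraMap ℝ C(X, ℝ) r) x = r + (1 - r) * boxFun X 0 x
    by_cases h : (relImage X.rel x).Nonempty
    · obtain ⟨y, hy⟩ := h
      rw [X.boxFun_eq_of_isLeast _ hy fun _ _ => le_rfl,
        X.boxFun_eq_of_isLeast 0 hy fun _ _ => le_rfl]
      simp
    · simp only [X.boxFun_of_isEmpty _ h]
      ring
  box_pos f := by
    ext x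
    change boxFun X (f ⊔ 0) x = boxFun X f x ⊔ 0
    by_cases h : (relImage X.rel x).Nonempty
    · obtain ⟨y, hy, hfy, hymin⟩ := X.exists_boxFun_eq f h
      rw [hfy]
      exact X.boxFun_eq_of_isLeast _ hy fun w hw => sup_le_sup_right (hymin w hw) 0
    · simp [X.boxFun_of_isEmpty _ h]
  box_add_const f r := by
    ext x
    change boxFun X (f + algebraMap ℝ C(X, ℝ) r) x
      = boxFun X f x + boxFun X (algebraMap ℝ C(X, ℝ) r) x - boxFun X 0 x
    by_cases h : (relImage X.rel x).Nonempty
    · obtain ⟨y, hy, hfy, hymin⟩ := X.exists_boxFun_eq f h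
      rw [hfy, X.boxFun_eq_of_isLeast (algebraMap ℝ C(X, ℝ) r) hy fun _ _ => le_rfl,
        X.boxFun_eq_of_isLeast 0 hy fun _ _ => le_rfl, X.boxFun_eq_of_isLeast _ hy]
      · simp
      · exact fun w hw => add_le_add_left (hymin w hw) r
    · simp only [X.boxFun_of_isEmpty _ h]
      ring
  box_smul f r hr := by
    ext x
    change boxFun X (r • f) x = boxFun X (algebraMap ℝ C(X, ℝ) r) x * boxFun X f x
    by_cases h : (relImage X.rel x).Nonempty
    · obtain ⟨y, hy, hfy, hymin⟩ := X.exists_boxFun_eq f h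
      rw [hfy, X.boxFun_eq_of_isLeast (algebraMap ℝ C(X, ℝ) r) hy fun _ _ => le_rfl,
        X.boxFun_eq_of_isLeast _ hy]
      · simp
      · exact fun w hw => mul_le_mul_of_nonneg_left (hymin w hw) hr
    · simp only [X.boxFun_of_isEmpty _ h]
      ring

theorem boxFun_map {X Y : KHK.{u}} (φ : X ⟶ Y) (f : C(Y, ℝ)) (x : X) :
    boxFun Y f (φ.toContinuousMap x) = boxFun X (f.comp φ.toContinuousMap) x := by
  have h : (relImage Y.rel (φ.toContinuousMap x)).Nonempty ↔ (relImage X.rel x).Nonempty := by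
    rw [← φ.isBounded x, Set.image_nonempty]
  rw [boxFun, boxFun, ContinuousMap.coe_comp, Set.image_comp, φ.isBounded x]
  by_cases hx : (relImage X.rel x).Nonempty
  · rw [if_pos hx, if_pos (h.mpr hx)]
  · rw [if_neg hx, if_neg (h.not.mpr hx)]

end KHK

theorem starWellDefined : StarWellDefined.{u} where
  continuous_box := KHK.continuous_boxFun
  isModal := KHK.isModalOperator_boxFun
  map_box _ _ := KHK.boxFun_map

/-! ### The counit -/

namespace KHK

variable (X : KHK.{u})

/-- The ideal of continuous functions that vanish at `x`. -/
noncomputable def vanishingIdeal (x : X) : Ideal (starObj starWellDefined X) :=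
  RingHom.ker (ContinuousMap.evalAlgHom ℝ ℝ x : C(X, ℝ) →ₐ[ℝ] ℝ)

variable {X}

theorem mem_vanishingIdeal {x : X} {f : starObj starWellDefined X} :
    f ∈ vanishingIdeal X x ↔ starObj.toFun starWellDefined X f x = 0 := Iff.rfl

theorem isMaximalLIdeal_vanishingIdeal (x : X) : IsMaximalLIdeal (vanishingIdeal X x) := by
  refine MBAL.isMaximalLIdeal_of_exists_sub_mem ?_ ?_ ?_
  · intro f g hfg hg
    have h1 : |starObj.toFun _ X f x| ≤ |starObj.toFun _ X g x| := hfg x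
    rw [mem_vanishingIdeal] at hg ⊢
    rwa [hg, abs_zero, abs_nonpos_iff] at h1
  · exact fun h => one_ne_zero (α := ℝ) (mem_vanishingIdeal.mp h)
  · exact fun f => ⟨starObj.toFun _ X f x, sub_self (starObj.toFun _ X f x)⟩

/-- The point of the Yosida space of `C(X)` given by a point of `X`. -/
noncomputable def toYosida (x : X) : (starObj starWellDefined X).Yosida :=
  ⟨vanishingIdeal X x, isMaximalLIdeal_vanishingIdeal x⟩

theorem val_toYosida (x : X) (f : starObj starWellDefined X) :
    (toYosida x).val f = starObj.toFun _ X f x := by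
  rw [MBAL.Yosida.val_eq_iff]
  exact sub_self (starObj.toFun _ X f x)

theorem continuous_toYosida : Continuous (toYosida (X := X)) :=
  MBAL.continuous_of_continuous_val fun f => by
    simpa only [val_toYosida] using (starObj.toFun _ X f).continuous

theorem exists_eq_zero_of_notMem {F : Set X} (hF : IsClosed F) {x : X} (hx : x ∉ F) :
    ∃ f : C(X, ℝ), 0 ≤ f ∧ f x = 0 ∧ ∀ y ∈ F, f y = 1 := by
  obtain ⟨f, h0, h1, hf⟩ := exists_continuous_zero_one_of_isClosed
    (isClosed_singleton (x := x)) hF (Set.disjoint_singleton_left.mpr hx)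
  exact ⟨f, fun y => (hf y).1, h0 rfl, fun y hy => h1 hy⟩

theorem toYosida_injective : Function.Injective (toYosida (X := X)) := by
  intro x y hxy
  by_contra hne
  obtain ⟨f, -, h0, h1⟩ := exists_eq_zero_of_notMem (isClosed_singleton (x := y)) hne
  have h2 := congrArg (fun M : (starObj starWellDefined X).Yosida => M.val f) hxy
  have h3 : f x = f y := (val_toYosida x f).symm.trans (h2.trans (val_toYosida y f))
  rw [h0, h1 y rfl] at h3
  exact zero_ne_one h3

/-- The range is compact, hence of the form `Z(I)`. Functions in `I` vanish at every point of `X`,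
so they are zero and `Z(I)` is the whole space. -/
theorem toYosida_surjective : Function.Surjective (toYosida (X := X)) := by
  obtain ⟨I, -, hI⟩ := MBAL.isClosed_iff.mp (isCompact_range (continuous_toYosida (X := X))).isClosed
  intro M
  change M ∈ Set.range toYosida
  rw [hI, MBAL.mem_zeroSet_iff]
  intro f hf
  have h0 : starObj.toFun _ X f = 0 := by
    ext x
    have hx : toYosida x ∈ (starObj starWellDefined X).zeroSet I := hI ▸ ⟨x, rfl⟩
    rw [← val_toYosida]
    exact MBAL.mem_zeroSet_iff.mp hx f hf
  have h1 : f = 0 := h0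
  rw [h1, map_zero]

/-- If `y ∉ R[x]`, a Urysohn function that is `0` at `y` and `1` on `R[x]` has box `1` at `x`; for
empty `R[x]` this is the default value. -/
theorem yosidaRel_toYosida_iff {x y : X} :
    (starObj starWellDefined X).yosidaRel (toYosida x) (toYosida y) ↔ X.rel x y := by
  constructor
  · intro h
    by_contra hxy
    obtain ⟨f, hf, h0, h1⟩ := exists_eq_zero_of_notMem (X.isContinuousRel.isClosed_image x) hxy
    have h2 : boxFun X f x = 0 := h f h0 hf
    by_cases hne : (relImage X.rel x).Nonempty
    · obtain ⟨z, hz, he, -⟩ := X.exists_boxFun_eq f hne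
      rw [he, h1 z hz] at h2
      exact one_ne_zero h2
    · rw [X.boxFun_of_isEmpty f hne] at h2
      exact one_ne_zero h2
  · intro h f hf hf0
    change boxFun X (starObj.toFun _ X f) x = 0
    rw [X.boxFun_eq_of_isLeast _ h]
    · exact hf
    · intro z _
      rw [show starObj.toFun _ X f y = 0 from hf]
      exact hf0 z

theorem isBoundedMorphism_toYosida :
    IsBoundedMorphism X.rel (starObj starWellDefined X).yosidaRel toYosida := by
  intro x
  ext M
  obtain ⟨y, rfl⟩ := toYosida_surjective M
  rw [toYosida_injective.mem_set_image]
  exact yosidaRel_toYosida_iff.symm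

variable (X) in
/-- The counit `ε_X : X → Y_{C(X)}`. -/
noncomputable def epsilon : X ⟶ yosidaObj yosidaWellDefined (starObj starWellDefined X) where
  toContinuousMap := ⟨toYosida, continuous_toYosida⟩
  isBounded := isBoundedMorphism_toYosida

/-- A bijective morphism of compact Hausdorff frames is an isomorphism. -/
theorem isIso_of_bijective {X Y : KHK.{u}} (φ : X ⟶ Y)
    (h : Function.Bijective φ.toContinuousMap) : IsIso φ := by
  let e : X ≃ₜ Y := Continuous.homeoOfEquivCompactToT2
    (f := Equiv.ofBijective φ.toContinuousMap h) φ.toContinuousMap.continuous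
  have he : ∀ x, e x = φ.toContinuousMap x := fun _ => rfl
  let ψ : Y ⟶ X :=
    { toContinuousMap := ⟨e.symm, e.symm.continuous⟩
      isBounded := fun y => by
        have h1 := φ.isBounded (e.symm y)
        rw [← he, e.apply_symm_apply] at h1
        rw [← h1]
        change e.symm '' (e '' _) = _
        rw [← Set.image_comp]
        simp }
  refine ⟨ψ, ?_, ?_⟩
  · exact Hom.ext (ContinuousMap.ext fun x => e.symm_apply_apply x)
  · exact Hom.ext (ContinuousMap.ext fun y => e.apply_symm_apply y)

instance : IsIso (epsilon X) :=
  isIso_of_bijective _ ⟨toYosida_injective, toYosida_surjective⟩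

end KHK

/-! ### The unit -/

namespace MBAL

variable (A : MBAL.{u})

/-- The homomorphism `ζ_A : A → C(Y_A)` of algebras. -/
noncomputable def zetaAlgHom : A →ₐ[ℝ] C(A.Yosida, ℝ) where
  toFun a := ⟨fun M => M.val a, continuous_val a⟩
  map_one' := ContinuousMap.ext fun M => map_one M.val
  map_zero' := ContinuousMap.ext fun M => map_zero M.val
  map_add' a b := ContinuousMap.ext fun M => map_add M.val a b
  map_mul' a b := ContinuousMap.ext fun M => map_mul M.val a b
  commutes' r := ContinuousMap.ext fun M => M.val_algebraMap r

theorem boxFun_val (a : A) (x : A.Yosida) :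
    boxFun (yosidaObj yosidaWellDefined A) (A.zetaAlgHom a) x = x.val (A.box a) := by
  by_cases h0 : x.val (A.box 0) = 0
  · obtain ⟨y, hxy, hy⟩ := Yosida.exists_rel_val_eq h0 a
    rw [← hy]
    exact KHK.boxFun_eq_of_isLeast (yosidaObj yosidaWellDefined A) (A.zetaAlgHom a) hxy
      fun z hz => hy.trans_le (Yosida.val_box_le_of_rel hz a)
  · rw [x.val_box_eq_one h0]
    exact KHK.boxFun_of_isEmpty _ _ fun ⟨_, hy⟩ => h0 (Yosida.val_box_zero_of_rel hy)

/-- The unit `ζ_A : A → C(Y_A)`. -/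
noncomputable def zeta : A ⟶ starObj starWellDefined (yosidaObj yosidaWellDefined A) where
  toAlgHom := A.zetaAlgHom
  map_sup a b := ContinuousMap.ext fun M => M.val_sup a b
  map_inf a b := ContinuousMap.ext fun M => M.val_inf a b
  map_box a := ContinuousMap.ext fun x => (A.boxFun_val a x).symm

theorem zetaAlgHom_injective : Function.Injective A.zetaAlgHom := fun _ _ h =>
  eq_iff_val_eq.mpr fun M => DFunLike.congr_fun h M

/-! ### The norm as a sup norm, and the image of `ζ` -/

theorem balNorm_eq_norm_of_le_iff {A : Type u} [CommRing A] [Lattice A] [Algebra ℝ A]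
    {X : Type*} [TopologicalSpace X] [CompactSpace X] {a : A} {f : C(X, ℝ)}
    (h : ∀ r : ℝ, |a| ≤ algebraMap ℝ A r ↔ ∀ x, |f x| ≤ r) : balNorm a = ‖f‖ := by
  simp only [balNorm, h]
  rcases isEmpty_or_nonempty X with hX | hX
  -- On the empty space every real is a bound, and `sInf` of all of `ℝ` is `0` by convention.
  · have : f = 0 := ContinuousMap.ext fun x => hX.elim x
    simp [this]
  · have : {r : ℝ | ∀ x, |f x| ≤ r} = Set.Ici ‖f‖ := by
      ext r
      exact (f.norm_le_of_nonempty).symm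
    rw [this, csInf_Ici]

theorem balNorm_eq_norm_zeta (a : A) : balNorm a = ‖A.zetaAlgHom a‖ :=
  balNorm_eq_norm_of_le_iff fun r => by
    rw [le_iff_val_le]
    refine forall_congr' fun M => ?_
    rw [M.val_abs, M.val_algebraMap]
    rfl

theorem balNorm_continuousMap {X : Type u} [TopologicalSpace X] [CompactSpace X] (f : C(X, ℝ)) :
    balNorm f = ‖f‖ :=
  balNorm_eq_norm_of_le_iff fun _ => Iff.rfl

theorem isUniformlyComplete_continuousMap (X : Type u) [TopologicalSpace X] [CompactSpace X] :
    IsUniformlyComplete C(X, ℝ) := by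
  intro s hs
  simp only [balNorm_continuousMap, ← dist_eq_norm] at hs ⊢
  obtain ⟨f, hf⟩ := cauchySeq_tendsto_of_complete (Metric.cauchySeq_iff.mpr hs)
  exact ⟨f, Metric.tendsto_atTop.mp hf⟩

/-- Stone–Weierstrass: distinct maximal `ℓ`-ideals are separated by values of elements of `A`. -/
theorem denseRange_zetaAlgHom : DenseRange A.zetaAlgHom := by
  have h := ContinuousMap.subalgebra_topologicalClosure_eq_top_of_separatesPoints
    A.zetaAlgHom.range (by
      intro M N hMN
      obtain ⟨a, ha⟩ := exists_val_ne hMN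
      exact ⟨_, ⟨_, ⟨a, rfl⟩, rfl⟩, ha⟩)
  intro f
  have hf : f ∈ A.zetaAlgHom.range.topologicalClosure := by rw [h]; trivial
  exact hf

/-- As `ζ` preserves norms, a sequence of images converging to `f` comes from a Cauchy sequence in
`A`, whose limit is sent to `f`. -/
theorem zetaAlgHom_surjective (hA : IsUniformlyComplete A) :
    Function.Surjective A.zetaAlgHom := by
  intro f
  obtain ⟨u, hu, hlim⟩ := mem_closure_iff_seq_limit.mp (A.denseRange_zetaAlgHom f)
  choose s hs using hu
  obtain ⟨a, ha⟩ := hA s fun ε hε => by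
    obtain ⟨N, hN⟩ := Metric.cauchySeq_iff.mp hlim.cauchySeq ε hε
    refine ⟨N, fun m hm n hn => ?_⟩
    rw [balNorm_eq_norm_zeta, map_sub, hs, hs, ← dist_eq_norm]
    exact hN m hm n hn
  refine ⟨a, tendsto_nhds_unique (Metric.tendsto_atTop.mpr fun ε hε => ?_) hlim⟩
  obtain ⟨N, hN⟩ := ha ε hε
  refine ⟨N, fun n hn => ?_⟩
  rw [dist_eq_norm, ← hs, ← map_sub, ← balNorm_eq_norm_zeta]
  exact hN n hn

/-- A bijective morphism of modal bounded archimedean `ℓ`-algebras is an isomorphism. -/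
theorem isIso_of_bijective {A B : MBAL.{u}} (α : A ⟶ B) (h : Function.Bijective α.toAlgHom) :
    IsIso α := by
  let e : A ≃ₐ[ℝ] B := AlgEquiv.ofBijective α.toAlgHom h
  have he : ∀ b, α.toAlgHom (e.symm b) = b := e.apply_symm_apply
  let β : B ⟶ A :=
    { toAlgHom := e.symm
      map_sup := fun a b => h.1 (by
        rw [α.map_sup]
        exact (he _).trans (congrArg₂ _ (he a).symm (he b).symm))
      map_inf := fun a b => h.1 (by
        rw [α.map_inf]
        exact (he _).trans (congrArg₂ _ (he a).symm (he b).symm))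
      map_box := fun a => h.1 (by
        rw [α.map_box]
        exact (he _).trans (congrArg _ (he a).symm)) }
  refine ⟨β, ?_, ?_⟩
  · exact Hom.ext (AlgHom.ext fun a => e.symm_apply_apply a)
  · exact Hom.ext (AlgHom.ext fun b => e.apply_symm_apply b)

theorem isIso_zeta (hA : IsUniformlyComplete A) : IsIso A.zeta :=
  isIso_of_bijective _ ⟨A.zetaAlgHom_injective, A.zetaAlgHom_surjective hA⟩

end MBAL

/-! ### The adjunction -/

/-- The dual adjunction between `MBAL` and `KHK`. -/
noncomputable def yosidaAdjunction :
    (yosidaFunctor.{u} yosidaWellDefined).rightOp ⊣ starFunctor starWellDefined :=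
  Adjunction.mkOfUnitCounit
    { unit :=
        { app := MBAL.zeta
          naturality := fun _ _ α => MBAL.Hom.ext (AlgHom.ext fun a =>
            ContinuousMap.ext fun M => (MBAL.Hom.val_comap α M a).symm) }
      counit :=
        { app := fun X => (KHK.epsilon X.unop).op
          naturality := fun _ _ _ => rfl }
      left_triangle := by
        ext A
        refine Quiver.Hom.unop_inj (KHK.Hom.ext (ContinuousMap.ext fun M => ?_))
        -- Points of `Y_A` are determined by their values, and the composite gives `a` the value
        -- `ζ(a)(M) = M.val a`.
        refine MBAL.eq_of_val_eq fun a => ?_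
        refine (MBAL.Hom.val_comap A.zeta _ a).trans ?_
        exact KHK.val_toYosida (X := yosidaObj yosidaWellDefined A) M _
      right_triangle := by
        ext X
        refine MBAL.Hom.ext (AlgHom.ext fun f => ContinuousMap.ext fun x => ?_)
        exact KHK.val_toYosida (X := X.unop) x f }

theorem isZeta_zeta (A : MBAL.{u}) : IsZeta starWellDefined yosidaWellDefined A A.zeta :=
  fun _ M _ => MBAL.Yosida.val_eq_iff M

theorem isEpsilon_epsilon (X : KHK.{u}) :
    IsEpsilon starWellDefined yosidaWellDefined X (KHK.epsilon X) :=
  fun _ _ => KHK.mem_vanishingIdeal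

theorem uniformlyComplete_starFunctor (X : KHK.{u}ᵒᵖ) :
    MBAL.uniformlyComplete ((starFunctor starWellDefined).obj X) :=
  MBAL.isUniformlyComplete_continuousMap X.unop

instance (A : MUBAL.{u}) : IsIso (yosidaAdjunction.unit.app A.obj) :=
  A.obj.isIso_zeta A.property

instance (X : KHK.{u}ᵒᵖ) : IsIso (yosidaAdjunction.counit.app X) :=
  inferInstanceAs (IsIso (KHK.epsilon X.unop).op)

/-- The functor `X ↦ C(X)` with values in the uniformly complete algebras. -/
noncomputable abbrev starFunctorUC : KHK.{u}ᵒᵖ ⥤ MUBAL.{u} :=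
  MBAL.uniformlyComplete.lift (starFunctor starWellDefined) uniformlyComplete_starFunctor

/-- On the uniformly complete algebras, `ζ` is a natural isomorphism. -/
noncomputable def zetaIso :
    𝟭 MUBAL.{u} ≅ (MBAL.uniformlyComplete.ι ⋙ (yosidaFunctor yosidaWellDefined).rightOp) ⋙
      starFunctorUC :=
  NatIso.ofComponents
    (fun A => MBAL.uniformlyComplete.isoMk (asIso (yosidaAdjunction.unit.app A.obj)))
    fun f => ObjectProperty.hom_ext _ (yosidaAdjunction.unit.naturality f.hom)

/-- The dual equivalence between `MUBAL` and `KHK`. -/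
noncomputable def yosidaEquivalence : MUBAL.{u} ≌ KHK.{u}ᵒᵖ where
  functor := MBAL.uniformlyComplete.ι ⋙ (yosidaFunctor yosidaWellDefined).rightOp
  inverse := starFunctorUC
  unitIso := zetaIso
  counitIso := NatIso.ofComponents (fun X => asIso (yosidaAdjunction.counit.app X))
    fun f => yosidaAdjunction.counit.naturality f
  functor_unitIso_comp A := yosidaAdjunction.left_triangle_components A.obj

/-- `C(Y_{ζ_A}) = ζ_{C(Y_A)}`. -/
theorem starFunctor_map_yosidaFunctor_map_unit (A : MBAL.{u}) :
    (starFunctor starWellDefined).map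
        ((yosidaFunctor yosidaWellDefined).rightOp.map (yosidaAdjunction.unit.app A)) =
      yosidaAdjunction.unit.app ((starFunctor starWellDefined).obj
        ((yosidaFunctor yosidaWellDefined).rightOp.obj A)) := by
  -- The counit is invertible, hence so is its image; composed with that image, both sides are the
  -- identity by the two triangle identities.
  rw [← cancel_mono ((starFunctor starWellDefined).map (yosidaAdjunction.counit.app
      ((yosidaFunctor yosidaWellDefined).rightOp.obj A))), ← Functor.map_comp]
  exact (congrArg _ (yosidaAdjunction.left_triangle_components A)).trans
    ((CategoryTheory.Functor.map_id _ _).trans (yosidaAdjunction.right_triangle_components _).symm)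

/-- `MUBAL` is reflective in `MBAL`, with reflector `A ↦ C(Y_A)` and unit `ζ`. -/
noncomputable def uniformlyCompleteReflection :
    (yosidaFunctor.{u} yosidaWellDefined).rightOp ⋙ starFunctorUC ⊣
      MBAL.uniformlyComplete.{u}.ι :=
  Adjunction.mkOfUnitCounit
    { unit :=
        { app := fun A => yosidaAdjunction.unit.app A
          naturality := fun _ _ f => yosidaAdjunction.unit.naturality f }
      counit := zetaIso.inv
      left_triangle := by
        ext A
        -- Since the reflector sends `ζ_A` to `ζ` at `C(Y_A)`, the triangle says that `ζ` followed
        -- by its inverse is the identity.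
        refine Eq.trans ?_ (IsIso.hom_inv_id (yosidaAdjunction.unit.app (starFunctorUC.obj
          ((yosidaFunctor yosidaWellDefined).rightOp.obj A)).obj))
        refine congrArg₂ (· ≫ ·) (starFunctor_map_yosidaFunctor_map_unit A) ?_
        exact Category.id_comp _
      right_triangle := by
        ext A
        refine Eq.trans ?_ (IsIso.hom_inv_id (yosidaAdjunction.unit.app A.obj))
        exact congrArg (_ ≫ ·) (Category.id_comp _) }

theorem mainTheorem1 :
    -- the two assignments are contravariant functors
    ∃ (hS : StarWellDefined.{u}) (hY : YosidaWellDefined.{u})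
      -- they form a dual adjunction
      (adj : (yosidaFunctor hY).rightOp ⊣ starFunctor hS)
      -- the functor `C(-)` takes uniformly complete values
      (hC : ∀ X : KHK.{u}ᵒᵖ, MBAL.uniformlyComplete ((starFunctor hS).obj X)),
      -- the unit is `ζ` and the counit is `ε`
      (∀ A : MBAL.{u}, IsZeta hS hY A (adj.unit.app A)) ∧
      (∀ X : KHK.{u}, IsEpsilon hS hY X (adj.counit.app (op X)).unop) ∧
      -- `MUBAL` is reflective in `MBAL`, with reflector `A ↦ C(Y_A)` and unit `ζ`
      (∃ refl : (yosidaFunctor hY).rightOp ⋙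
            MBAL.uniformlyComplete.lift (starFunctor hS) hC ⊣ MBAL.uniformlyComplete.{u}.ι,
        ∀ A : MBAL.{u}, refl.unit.app A = adj.unit.app A) ∧
      -- the adjunction restricts to a dual equivalence between `MUBAL` and `KHK`
      (∀ A : MBAL.{u}, MBAL.uniformlyComplete A → IsIso (adj.unit.app A)) ∧
      (∀ X : KHK.{u}ᵒᵖ, IsIso (adj.counit.app X)) ∧
      (∃ e : MUBAL.{u} ≌ KHK.{u}ᵒᵖ,
        e.functor = MBAL.uniformlyComplete.ι ⋙ (yosidaFunctor hY).rightOp ∧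
        e.inverse = MBAL.uniformlyComplete.lift (starFunctor hS) hC) := by
  refine ⟨starWellDefined, yosidaWellDefined, yosidaAdjunction, uniformlyComplete_starFunctor,
    isZeta_zeta, isEpsilon_epsilon, ⟨uniformlyCompleteReflection, fun _ => rfl⟩,
    fun A hA => A.isIso_zeta hA, fun _ => inferInstance, yosidaEquivalence, rfl, rfl⟩
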